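/- Let $H=L^2([0,1];\mathbb{C})$ and let $H^1[0,1]$ be the space of absolutely continuous $u:[0,1]\to\mathbb{C}$ with $u'\in L^2[0,1]$. For $\lambda\in[-\pi,\pi]$ let $\mathcal{A}_\lambda$ be the operator $\mathcal{A}_\lambda u=iu'$ on $\mathcal{D}(\mathcal{A}_\lambda)=\{u\in H^1[0,1]:u(0)=e^{i\lambda}u(1)\}\subset H$. Let $\mathcal{CF}^{sa}(H)$ be the set of all densely defined selfadjoint operators on $H$ that are Fredholm (closed, with finite-dimensional kernel and image of finite codimension), with the gap metric $d_G(S,T)=\|\kappa(S)-\kappa(T)\|$, where $\kappa(T)=(T-i)(T+i)^{-1}$. For a continuous path $\mathcal{B}:[a,b]\to\mathcal{CF}^{sa}(H)$, choose $a=\lambda_0\le\lambda_1\le\dots\le\lambda_n=b$ and $r_1,\dots,r_n>0$ such that, for all $\lambda\in[\lambda_{i-1},\lambda_i]$, the numbers $\pm r_i$ lie in the resolvent set of $\mathcal{B}_\lambda$, and the spectral projections $\chi_{[-r_i,r_i]}(\mathcal{B}_\lambda)=\frac1{2\pi i}\int_{|z|=r_i}(z-\mathcal{B}_\lambda)^{-1}\,dz$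 depend norm-continuously on $\lambda\in[\lambda_{i-1},\lambda_i]$ and have constant finite rank. The spectral flow of $\mathcal{B}$ is $$\operatorname{sf}(\mathcal{B})=\sum_{i=1}^n\bigl(\dim E_{[0,r_i]}(\mathcal{B}_{\lambda_i})-\dim E_{[0,r_i]}(\mathcal{B}_{\lambda_{i-1}})\bigr),\qquad E_{[c,d]}(T)=\bigoplus_{\mu\in[c,d]}\ker(\mu-T).$$ Then $\mathcal{A}_\lambda\in\mathcal{CF}^{sa}(H)$ for every $\lambda\in[-\pi,\pi]$, the map $\lambda\mapsto\mathcal{A}_\lambda$ is continuous with respect to the gap metric, and $\mathcal{A}_{-\pi}=\mathcal{A}_\pi$. Such a choice of $\lambda_i$, $r_i$ exists for the path $\mathcal{A}=\{\mathcal{A}_\lambda\}_{\lambda\in[-\pi,\pi]}$, every such choice yields the value $1$ of the sum above, and so $\operatorname{sf}(\mathcal{A})=1$. Moreover, the class of the loop $\mathcal{A}$ in the fundamental group $\pi_1(\mathcal{CF}^{sa}(H),\mathcal{A}_{-\pi})$ is not the identity. -/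

import Mathlib

open MeasureTheory Set
open scoped Topology unitInterval ENNReal

noncomputable section

namespace SpectralFlow

/-! ### Unbounded operators on a complex Hilbert space -/

section Operators

variable {H : Type*} [NormedAddCommGroup H] [InnerProductSpace ℂ H]

/-- The resolvent set of an operator `T` with domain `T.domain ⊆ H`: all `z` such that
`z - T : T.domain → H` is bijective with bounded inverse. -/
def resolventSet (T : H →ₗ.[ℂ] H) : Set ℂ :=
  {z | Function.Bijective (fun u : T.domain => z • (u : H) - T u) ∧
    ∃ R : H →L[ℂ] H, ∀ u : T.domain, R (z • (u : H) - T u) = u}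

open Classical in
/-- The resolvent `(z - T)⁻¹` as a bounded operator on `H`, for `z` in the resolvent set of `T`
(and `0` for the other `z`). -/
def resolvent (T : H →ₗ.[ℂ] H) (z : ℂ) : H →L[ℂ] H :=
  if h : z ∈ resolventSet T then h.2.choose else 0

/-- A Fredholm operator: closed, with finite-dimensional kernel and a range of finite
codimension. -/
def IsFredholm (T : H →ₗ.[ℂ] H) : Prop :=
  T.IsClosed ∧ FiniteDimensional ℂ (LinearMap.ker T.toFun) ∧
    FiniteDimensional ℂ (H ⧸ LinearMap.range T.toFun)

/-- The Cayley transform `κ(T) = 1 - 2i (T + i)⁻¹ = (T - i) (T + i)⁻¹` of a selfadjoint operator.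
Note `resolvent T (-i) = - (T + i)⁻¹`; see `cayley_apply` for the second expression. -/
def cayley (T : H →ₗ.[ℂ] H) : H →L[ℂ] H :=
  1 + (2 * Complex.I) • resolvent T (-Complex.I)

/-- The Riesz spectral projection `(2πi)⁻¹ ∮ (z - T)⁻¹ dz` belonging to the interval `[a, b]`;
the circle of integration has the segment `[a, b]` as a diameter. -/
def spectralProjection (T : H →ₗ.[ℂ] H) (a b : ℝ) : H →L[ℂ] H :=
  (2 * (Real.pi : ℂ) * Complex.I)⁻¹ •
    ∮ z in C(((a + b) / 2 : ℝ), (b - a) / 2), resolvent T z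

/-- The eigenspace `ker (μ - T)`, as a subspace of `H`. -/
def eigenspace (T : H →ₗ.[ℂ] H) (μ : ℂ) : Submodule ℂ H :=
  (LinearMap.ker (μ • T.domain.subtype - T.toFun)).map T.domain.subtype

/-- The sum of the eigenspaces of `T` with eigenvalues in the interval `[c, d]`. -/
def eigenspaceSum (T : H →ₗ.[ℂ] H) (c d : ℝ) : Submodule ℂ H :=
  ⨆ μ ∈ Icc c d, eigenspace T (μ : ℂ)

theorem resolvent_left {T : H →ₗ.[ℂ] H} {z : ℂ} (hz : z ∈ resolventSet T) (u : T.domain) :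
    resolvent T z (z • (u : H) - T u) = u := by
  rw [resolvent, dif_pos hz]
  exact hz.2.choose_spec u

theorem resolvent_right {T : H →ₗ.[ℂ] H} {z : ℂ} (hz : z ∈ resolventSet T) (v : H) :
    ∃ h : resolvent T z v ∈ T.domain,
      z • resolvent T z v - T ⟨resolvent T z v, h⟩ = v := by
  obtain ⟨u, hu⟩ := hz.1.2 v
  have hu' : z • (u : H) - T u = v := hu
  have e : resolvent T z v = u := by rw [← hu', resolvent_left hz]
  refine ⟨by rw [e]; exact u.2, ?_⟩
  have : (⟨resolvent T z v, by rw [e]; exact u.2⟩ : T.domain) = u := Subtype.ext e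
  rw [this, e, hu']

theorem resolvent_injective {S T : H →ₗ.[ℂ] H} {z : ℂ} (hS : z ∈ resolventSet S)
    (hT : z ∈ resolventSet T) (h : resolvent S z = resolvent T z) : S = T := by
  have key : ∀ {S T : H →ₗ.[ℂ] H}, z ∈ resolventSet S → z ∈ resolventSet T →
      resolvent S z = resolvent T z → S ≤ T := by
    intro S T hS hT h
    refine ⟨fun x hx => ?_, fun x y hxy => ?_⟩
    · obtain ⟨h1, -⟩ := resolvent_right hT (z • x - S ⟨x, hx⟩)
      rw [← h, resolvent_left hS ⟨x, hx⟩] at h1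
      exact h1
    · obtain ⟨h1, h2⟩ := resolvent_right hT (z • (x : H) - S x)
      have e : resolvent T z (z • (x : H) - S x) = y := by rw [← h, resolvent_left hS, hxy]
      have e' : (⟨resolvent T z (z • (x : H) - S x), h1⟩ : T.domain) = y := Subtype.ext e
      rw [e', e, hxy] at h2
      exact (sub_right_injective h2).symm
  exact le_antisymm (key hS hT h) (key hT hS h.symm)

variable [CompleteSpace H]

theorem neg_I_mem_resolventSet {T : H →ₗ.[ℂ] H} (hT : IsSelfAdjoint T) :
    -Complex.I ∈ resolventSet T := by
  have hd : Dense (T.domain : Set H) := hT.dense_domain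
  have hsym : ∀ x y : T.domain, inner ℂ (T x) (y : H) = inner ℂ (x : H) (T y) := by
    have := T.adjoint_isFormalAdjoint hd
    rw [LinearPMap.isSelfAdjoint_def.mp hT] at this
    exact fun x y => this x y
  have him : ∀ u : T.domain, RCLike.re (inner ℂ (T u) (Complex.I • (u : H))) = 0 := by
    intro u
    have h1 := hsym u u
    have h2 : (starRingEnd ℂ) (inner ℂ (T u) (u : H)) = inner ℂ (T u) (u : H) := by
      rw [inner_conj_symm, h1]
    have h3 := Complex.conj_eq_iff_im.mp h2
    rw [inner_smul_right]
    simp [h3]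
  set L : T.domain →ₗ[ℂ] H := (-Complex.I) • T.domain.subtype - T.toFun with hL
  have hLapp : ∀ u : T.domain, L u = (-Complex.I) • (u : H) - T u := fun u => rfl
  have hnorm : ∀ u : T.domain, ‖L u‖ ^ 2 = ‖T u‖ ^ 2 + ‖(u : H)‖ ^ 2 := by
    intro u
    have : L u = -(T u + Complex.I • (u : H)) := by rw [hLapp]; module
    rw [this, norm_neg, norm_add_sq (𝕜 := ℂ), him u, norm_smul]
    simp
  have hbd : ∀ u : T.domain, ‖(u : H)‖ ≤ ‖L u‖ := fun u =>
    le_of_sq_le_sq (by rw [hnorm u]; nlinarith [sq_nonneg ‖T u‖]) (norm_nonneg _)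
  have hinj : Function.Injective L := by
    rw [← LinearMap.ker_eq_bot, LinearMap.ker_eq_bot']
    intro u hu
    have := hbd u
    rw [hu, norm_zero] at this
    exact Subtype.ext (norm_le_zero_iff.mp this)
  have hclT : T.IsClosed := hT.isClosed
  have hcl : IsClosed ((LinearMap.range L : Submodule ℂ H) : Set H) := by
    rw [← isSeqClosed_iff_isClosed]
    intro v w hv hvw
    choose u hu using hv
    have hc : CauchySeq (fun n => ((u n : T.domain) : H)) := by
      have hvc := hvw.cauchySeq
      rw [Metric.cauchySeq_iff] at hvc ⊢
      intro ε hε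
      obtain ⟨N, hN⟩ := hvc ε hε
      refine ⟨N, fun m hm n hn => lt_of_le_of_lt ?_ (hN m hm n hn)⟩
      rw [dist_eq_norm, dist_eq_norm, ← hu m, ← hu n, ← map_sub]
      exact hbd (u m - u n)
    obtain ⟨x, hx⟩ := cauchySeq_tendsto_of_complete hc
    have hTu : Filter.Tendsto (fun n => T (u n)) Filter.atTop (𝓝 ((-Complex.I) • x - w)) := by
      have := (hx.const_smul (-Complex.I)).sub hvw
      refine this.congr fun n => ?_
      rw [← hu n, hLapp]; module
    have hmem : (x, (-Complex.I) • x - w) ∈ T.graph :=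
      hclT.mem_of_tendsto (hx.prodMk_nhds hTu)
        (Filter.Eventually.of_forall fun n => T.mem_graph (u n))
    obtain ⟨y, hy1, hy2⟩ := (LinearPMap.mem_graph_iff T).mp hmem
    refine ⟨y, ?_⟩
    rw [hLapp, hy2, hy1]; simp
  have hsurj : Function.Surjective L := by
    rw [← LinearMap.range_eq_top]
    have : CompleteSpace (LinearMap.range L) := hcl.completeSpace_coe
    rw [← Submodule.orthogonal_eq_bot_iff, Submodule.eq_bot_iff]
    intro y hy
    rw [Submodule.mem_orthogonal] at hy
    have hy' : ∀ x : T.domain, inner ℂ (Complex.I • y) (x : H) = inner ℂ y (T x) := by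
      intro x
      have h := hy (L x) ⟨x, rfl⟩
      have h' : inner ℂ y (L x) = 0 := inner_eq_zero_symm.mp h
      rw [hLapp, inner_sub_right, inner_smul_right, sub_eq_zero] at h'
      rw [← h', inner_smul_left]; simp
    have hyd : y ∈ T.adjoint.domain := T.mem_adjoint_domain_of_exists y ⟨_, hy'⟩
    have hTy : T.adjoint ⟨y, hyd⟩ = Complex.I • y := T.adjoint_apply_eq hd ⟨y, hyd⟩ hy'
    have hmem : (y, Complex.I • y) ∈ T.adjoint.graph :=
      (LinearPMap.mem_graph_iff _).mpr ⟨⟨y, hyd⟩, rfl, hTy⟩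
    rw [LinearPMap.isSelfAdjoint_def.mp hT] at hmem
    obtain ⟨z, hz1, hz2⟩ := (LinearPMap.mem_graph_iff T).mp hmem
    have h0 := him z
    rw [hz2, hz1] at h0
    rw [inner_self_eq_norm_sq, norm_smul, Complex.norm_I, one_mul] at h0
    exact norm_eq_zero.mp ((pow_eq_zero_iff two_ne_zero).mp h0)
  refine ⟨⟨hinj, hsurj⟩, ?_⟩
  let e := LinearEquiv.ofBijective L ⟨hinj, hsurj⟩
  refine ⟨LinearMap.mkContinuous (T.domain.subtype ∘ₗ (e.symm : H →ₗ[ℂ] T.domain)) 1 ?_, ?_⟩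
  · intro v
    have := hbd (e.symm v)
    have h2 : L (e.symm v) = v := e.apply_symm_apply v
    rw [h2] at this
    simpa using this
  · intro u
    have : e.symm (L u) = u := e.symm_apply_apply u
    simp only [LinearMap.mkContinuous_apply, LinearMap.comp_apply, LinearEquiv.coe_coe]
    rw [← hLapp, this]; rfl

/-- The Cayley transform of a selfadjoint operator is `(T - i) (T + i)⁻¹`:
one has `κ(T) (T u + i u) = T u - i u` for all `u` in the domain, and the vectors `T u + i u`
exhaust `H`. -/
theorem cayley_apply {T : H →ₗ.[ℂ] H} (hT : IsSelfAdjoint T) (u : T.domain) :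
    cayley T (T u + Complex.I • (u : H)) = T u - Complex.I • (u : H) := by
  have h := resolvent_left (neg_I_mem_resolventSet hT) u
  have e : T u + Complex.I • (u : H) = -((-Complex.I) • (u : H) - T u) := by module
  have h2 : resolvent T (-Complex.I) (T u + Complex.I • (u : H)) = -(u : H) := by
    rw [e, map_neg, h]
  simp only [cayley, add_apply, smul_apply, one_apply_eq_self, h2]
  module

end Operators

/-! ### Selfadjoint Fredholm operators with the gap metric -/

/-- The set `CF^sa(H)` of (densely defined) selfadjoint Fredholm operators on `H`. -/
def SelfAdjointFredholm (H : Type*) [NormedAddCommGroup H] [InnerProductSpace ℂ H]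
    [CompleteSpace H] : Type _ :=
  {T : H →ₗ.[ℂ] H // IsSelfAdjoint T ∧ IsFredholm T}

section Gap

variable {H : Type*} [NormedAddCommGroup H] [InnerProductSpace ℂ H] [CompleteSpace H]

/-- The underlying unbounded operator. -/
def SelfAdjointFredholm.toLinearPMap (T : SelfAdjointFredholm H) : H →ₗ.[ℂ] H := T.1

theorem SelfAdjointFredholm.cayley_injective :
    Function.Injective (fun T : SelfAdjointFredholm H => cayley T.toLinearPMap) := by
  intro S T h
  refine Subtype.ext (resolvent_injective (neg_I_mem_resolventSet S.2.1)
    (neg_I_mem_resolventSet T.2.1) ?_)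
  have h' : (2 * Complex.I) • resolvent S.1 (-Complex.I) =
      (2 * Complex.I) • resolvent T.1 (-Complex.I) := add_left_cancel h
  exact smul_right_injective _ (by simp) h'

/-- The gap metric `d(S, T) = ‖κ(S) - κ(T)‖`. -/
instance : MetricSpace (SelfAdjointFredholm H) :=
  MetricSpace.induced (fun T => cayley T.toLinearPMap) SelfAdjointFredholm.cayley_injective
    inferInstance

theorem SelfAdjointFredholm.dist_eq (S T : SelfAdjointFredholm H) :
    dist S T = ‖cayley S.toLinearPMap - cayley T.toLinearPMap‖ :=
  dist_eq_norm (cayley S.toLinearPMap) (cayley T.toLinearPMap)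

/-! ### The spectral flow -/

/-- The data from which the spectral flow of a gap-continuous path `A : [a, b] → CF^sa(H)` is
computed: a partition `a = t₀ ≤ t₁ ≤ ⋯ ≤ tₙ = b` and numbers `r₁, …, rₙ > 0` such that, for `s` in
the `i`-th subinterval, `± rᵢ` lie in the resolvent set of `A s` and the spectral projections of
`A s` belonging to `[-rᵢ, rᵢ]` depend continuously on `s` and are of constant finite rank. -/
structure SpectralPartition {a b : ℝ} (A : C(Icc a b, SelfAdjointFredholm H)) where
  /-- the number of subintervals -/
  n : ℕ
  /-- the points of the partition -/
  t : Fin (n + 1) → Icc a b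
  /-- the spectral bounds -/
  r : Fin n → ℝ
  monotone_t : Monotone t
  t_zero : (t 0 : ℝ) = a
  t_last : (t (Fin.last n) : ℝ) = b
  r_pos : ∀ i, 0 < r i
  mem_resolventSet : ∀ i, ∀ s ∈ Icc (t i.castSucc) (t i.succ),
    (r i : ℂ) ∈ resolventSet (A s).toLinearPMap ∧ -(r i : ℂ) ∈ resolventSet (A s).toLinearPMap
  continuousOn : ∀ i, ContinuousOn
    (fun s => spectralProjection (A s).toLinearPMap (-(r i)) (r i))
    (Icc (t i.castSucc) (t i.succ))
  finite_rank : ∀ i, ∀ s ∈ Icc (t i.castSucc) (t i.succ), FiniteDimensional ℂ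
    (LinearMap.range (spectralProjection (A s).toLinearPMap (-(r i)) (r i) : H →ₗ[ℂ] H))
  constant_rank : ∀ i, ∀ s ∈ Icc (t i.castSucc) (t i.succ), ∀ s' ∈ Icc (t i.castSucc) (t i.succ),
    Module.finrank ℂ
      (LinearMap.range (spectralProjection (A s).toLinearPMap (-(r i)) (r i) : H →ₗ[ℂ] H)) =
    Module.finrank ℂ
      (LinearMap.range (spectralProjection (A s').toLinearPMap (-(r i)) (r i) : H →ₗ[ℂ] H))

/-- The sum `∑ᵢ (dim E_[0,rᵢ](A(tᵢ)) - dim E_[0,rᵢ](A(tᵢ₋₁)))`, where `E_[c,d](T)` is the sum of the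
eigenspaces of `T` with eigenvalues in `[c, d]`. -/
def SpectralPartition.value {a b : ℝ} {A : C(Icc a b, SelfAdjointFredholm H)}
    (P : SpectralPartition A) : ℤ :=
  ∑ i : Fin P.n,
    ((Module.finrank ℂ (eigenspaceSum (A (P.t i.succ)).toLinearPMap 0 (P.r i)) : ℤ) -
      (Module.finrank ℂ (eigenspaceSum (A (P.t i.castSucc)).toLinearPMap 0 (P.r i)) : ℤ))

open Classical in
/-- The spectral flow of a gap-continuous path of selfadjoint Fredholm operators: the value of any
partition as above. (Such partitions exist, and all of them have the same value.) -/
def spectralFlow {a b : ℝ} (A : C(Icc a b, SelfAdjointFredholm H)) : ℤ :=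
  if h : Nonempty (SpectralPartition A) then h.some.value else 0

end Gap

/-! ### Loops -/

/-- A closed path `A : [a, b] → X`, reparametrised linearly by the unit interval, as a loop based at
its starting point. -/
def loopOfClosedPath {X : Type*} [TopologicalSpace X] {a b : ℝ} (hab : a ≤ b) (A : C(Icc a b, X))
    (h : A ⟨a, left_mem_Icc.mpr hab⟩ = A ⟨b, right_mem_Icc.mpr hab⟩) :
    Path (A ⟨a, left_mem_Icc.mpr hab⟩) (A ⟨a, left_mem_Icc.mpr hab⟩) where
  toFun t := A ⟨a + t * (b - a), by
    have h0 := t.2.1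
    have h1 := t.2.2
    constructor <;> nlinarith⟩
  continuous_toFun := by fun_prop
  source' := by simp
  target' := by simp [h]

/-! ### The operators `i d/dt` with twisted periodic boundary conditions -/

/-- Lebesgue measure on `[0, 1]`. -/
abbrev volI : Measure ℝ := volume.restrict (Icc 0 1)

/-- The complex Hilbert space `L²[0, 1]`. -/
abbrev L2I : Type := Lp ℂ 2 volI

/-- `f` represents an element of `H¹[0, 1]` (it is absolutely continuous on `[0, 1]` with derivative
in `L²`) with `f 0 = e^{iθ} f 1`. -/
def IsTwistedH1 (θ : ℝ) (f : ℝ → ℂ) : Prop :=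
  AbsolutelyContinuousOnInterval f 0 1 ∧ MemLp (deriv f) 2 volI ∧
    f 0 = Complex.exp (Complex.I * θ) * f 1

theorem ae_volI_of_Ioo {p : ℝ → Prop} (h : ∀ x ∈ Ioo (0 : ℝ) 1, p x) : ∀ᵐ x ∂volI, p x := by
  rw [volI, ← restrict_Ioo_eq_restrict_Icc]
  exact (ae_restrict_iff' measurableSet_Ioo).mpr (Filter.Eventually.of_forall h)

theorem ae_differentiableAt_of_ac {f : ℝ → ℂ} (hf : AbsolutelyContinuousOnInterval f 0 1) :
    ∀ᵐ x ∂volI, DifferentiableAt ℝ f x := by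
  have h := hf.boundedVariationOn.locallyBoundedVariationOn.ae_differentiableWithinAt_of_mem
  rw [volI, ← restrict_Ioo_eq_restrict_Icc, ae_restrict_iff' measurableSet_Ioo]
  filter_upwards [h] with x hx hx'
  refine (hx ?_).differentiableAt ?_
  · rw [uIcc_of_le zero_le_one]; exact Ioo_subset_Icc_self hx'
  · rw [uIcc_of_le zero_le_one]; exact Icc_mem_nhds hx'.1 hx'.2

theorem deriv_add_ae {f g : ℝ → ℂ} (hf : AbsolutelyContinuousOnInterval f 0 1)
    (hg : AbsolutelyContinuousOnInterval g 0 1) :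
    deriv (f + g) =ᵐ[volI] deriv f + deriv g := by
  filter_upwards [ae_differentiableAt_of_ac hf, ae_differentiableAt_of_ac hg] with x h1 h2
  simpa using deriv_add h1 h2

theorem deriv_smul_ae {f : ℝ → ℂ} (c : ℂ) (hf : AbsolutelyContinuousOnInterval f 0 1) :
    deriv (c • f) =ᵐ[volI] c • deriv f := by
  filter_upwards [ae_differentiableAt_of_ac hf] with x h1
  simpa using deriv_const_smul c h1

theorem IsTwistedH1.add {θ : ℝ} {f g : ℝ → ℂ} (hf : IsTwistedH1 θ f) (hg : IsTwistedH1 θ g) :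
    IsTwistedH1 θ (f + g) :=
  ⟨hf.1.add hg.1, (hf.2.1.add hg.2.1).ae_eq (deriv_add_ae hf.1 hg.1).symm, by
    simp only [Pi.add_apply, hf.2.2, hg.2.2]; ring⟩

theorem IsTwistedH1.smul {θ : ℝ} {f : ℝ → ℂ} (c : ℂ) (hf : IsTwistedH1 θ f) :
    IsTwistedH1 θ (c • f) :=
  ⟨hf.1.const_smul c, (hf.2.1.const_smul c).ae_eq (deriv_smul_ae c hf.1).symm, by
    simp only [Pi.smul_apply, smul_eq_mul, hf.2.2]; ring⟩

/-- The derivative does not depend on the chosen absolutely continuous representative. -/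
theorem deriv_ae_unique {f g : ℝ → ℂ} (hf : AbsolutelyContinuousOnInterval f 0 1)
    (hg : AbsolutelyContinuousOnInterval g 0 1) (h : f =ᵐ[volI] g) :
    deriv f =ᵐ[volI] deriv g := by
  have hcf : ContinuousOn f (Ioo 0 1) := hf.continuousOn.mono (by
    rw [uIcc_of_le zero_le_one]; exact Ioo_subset_Icc_self)
  have hcg : ContinuousOn g (Ioo 0 1) := hg.continuousOn.mono (by
    rw [uIcc_of_le zero_le_one]; exact Ioo_subset_Icc_self)
  have heq : EqOn f g (Ioo 0 1) := by
    refine Measure.eqOn_open_of_ae_eq (μ := volume) ?_ isOpen_Ioo hcf hcg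
    rw [restrict_Ioo_eq_restrict_Icc]; exact h
  refine ae_volI_of_Ioo fun x hx => ?_
  exact Filter.EventuallyEq.deriv_eq
    (Filter.eventuallyEq_of_mem (isOpen_Ioo.mem_nhds hx) heq)

/-- The domain `{u ∈ H¹[0, 1] : u(0) = e^{iθ} u(1)}`, as a subspace of `L²[0, 1]`. -/
def twistedDomain (θ : ℝ) : Submodule ℂ L2I where
  carrier := {u | ∃ f : ℝ → ℂ, IsTwistedH1 θ f ∧ u =ᵐ[volI] f}
  add_mem' := by
    rintro u v ⟨f, hf, huf⟩ ⟨g, hg, hvg⟩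
    exact ⟨f + g, hf.add hg, (Lp.coeFn_add u v).trans (huf.add hvg)⟩
  zero_mem' := by
    refine ⟨0, ⟨?_, ?_, by simp⟩, Lp.coeFn_zero _ _ _⟩
    · exact ((LipschitzWith.const (0 : ℂ)).lipschitzOnWith (s := uIcc 0 1)).absolutelyContinuousOnInterval
    · have : deriv (0 : ℝ → ℂ) = 0 := by ext x; simp
      rw [this]; exact MemLp.zero
  smul_mem' := by
    rintro c u ⟨f, hf, huf⟩
    exact ⟨c • f, hf.smul c, (Lp.coeFn_smul c u).trans (huf.const_smul c)⟩

/-- The derivative `u' ∈ L²[0, 1]` of `u` in the domain. -/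
def twistedDeriv (θ : ℝ) (u : twistedDomain θ) : L2I :=
  u.2.choose_spec.1.2.1.toLp (deriv u.2.choose)

theorem twistedDeriv_eq {θ : ℝ} (u : twistedDomain θ) {f : ℝ → ℂ} (hf : IsTwistedH1 θ f)
    (huf : (u : L2I) =ᵐ[volI] f) : twistedDeriv θ u =ᵐ[volI] deriv f :=
  (MemLp.coeFn_toLp _).trans
    (deriv_ae_unique u.2.choose_spec.1.1 hf.1 (u.2.choose_spec.2.symm.trans huf))

/-- The operator `u ↦ i u'` on `L²[0, 1]` with domain
`{u ∈ H¹[0, 1] : u(0) = e^{iθ} u(1)}`. -/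
def twistedOperator (θ : ℝ) : L2I →ₗ.[ℂ] L2I where
  domain := twistedDomain θ
  toFun :=
    { toFun := fun u => Complex.I • twistedDeriv θ u
      map_add' := by
        intro u v
        obtain ⟨f, hf, huf⟩ := u.2
        obtain ⟨g, hg, hvg⟩ := v.2
        rw [← smul_add]
        congr 1
        refine Lp.ext ?_
        have h1 := twistedDeriv_eq (u + v) (hf.add hg)
          ((Lp.coeFn_add (u : L2I) (v : L2I)).trans (huf.add hvg))
        exact h1.trans ((deriv_add_ae hf.1 hg.1).trans
          (((twistedDeriv_eq u hf huf).add (twistedDeriv_eq v hg hvg)).symm.trans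
            (Lp.coeFn_add _ _).symm))
      map_smul' := by
        intro c u
        obtain ⟨f, hf, huf⟩ := u.2
        rw [RingHom.id_apply, smul_comm c]
        congr 1
        refine Lp.ext ?_
        have h1 := twistedDeriv_eq (c • u) (hf.smul c)
          ((Lp.coeFn_smul c (u : L2I)).trans (huf.const_smul c))
        exact h1.trans ((deriv_smul_ae c hf.1).trans
          (((twistedDeriv_eq u hf huf).const_smul c).symm.trans
            (Lp.coeFn_smul _ _).symm)) }

end SpectralFlow

end

/-! Everything rests on diagonalisation. The functions `e^{i(2πk-θ)t}`, `k ∈ ℤ`, form a Hilbert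
basis in which `twistedOperator θ` is the maximal multiplication operator with eigenvalues `θ - 2πk`
(`isDiagonal_twistedOperator`). Selfadjointness, the Fredholm property, resolvents, spectral
projections and the Cayley transform can then be read off coordinatewise. Gap continuity follows
because the moving basis is a fixed Fourier basis multiplied by `e^{-iθt}`, which depends
norm-continuously on `θ`.

For the spectral flow, `dim E_[0,r]` counts the integers between `(θ - r)/2π` and `θ/2π`. The lower
end contributes nothing on a subinterval where `r` stays in the resolvent set, and the floors of the
upper end telescope to `⌊1/2⌋ - ⌊-1/2⌋ = 1`.

For nontriviality, suppose the loop contracts. The Cayley transforms along the contraction form a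
compact family of unitaries `U` with `U + 1` Fredholm, so `U + 1` is bounded below by one `c > 0`
off one finite-dimensional `V` (`exists_isBoundedBelowOff`). For `a < 1` close to `1` the
determinant of the compression of `(U + a)⁻¹` to `V` is then continuous and never zero
(`compressionDet_ne_zero`), which turns the homotopy of operators into a homotopy of loops in the
punctured plane; having a closed logarithm is invariant under such homotopies. A second homotopy,
`cayleyHomotopy`, deforms the Cayley symbol until it equals `1` at all eigenvalues except the one
that crosses zero. There the determinant is explicit (`compressionDet_cayleyHomotopy_one`) and winds
once around the origin, a contradiction. -/

noncomputable section

namespace SpectralFlow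

/-! ### Diagonal operators with respect to a Hilbert basis -/

section Diagonal

variable {ι : Type*} {H : Type*} [NormedAddCommGroup H] [InnerProductSpace ℂ H]

open Classical in
/-- The bounded operator acting on the `k`-th vector of the Hilbert basis `b` as multiplication by
`c k`, for a bounded family `c` (and `0` if `c` is unbounded). -/
def diagOp (b : HilbertBasis ι ℂ H) (c : ι → ℂ) : H →L[ℂ] H :=
  if h : ∃ K : ℝ, 0 ≤ K ∧ ∀ k, ‖c k‖ ≤ K then
    (b.repr.symm.toContinuousLinearEquiv : _ →L[ℂ] H) ∘L
      lp.mapCLM 2 (fun k => ContinuousLinearMap.mul ℂ ℂ (c k)) h.choose_spec.1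
        (fun k => by simpa using h.choose_spec.2 k) ∘L
      (b.repr.toContinuousLinearEquiv : H →L[ℂ] _)
  else 0

variable {b : HilbertBasis ι ℂ H} {c d : ι → ℂ} {K : ℝ}

theorem repr_ext {x y : H} (h : ∀ k, b.repr x k = b.repr y k) : x = y :=
  b.repr.injective (lp.ext (funext h))

theorem repr_diagOp (hc : ∀ k, ‖c k‖ ≤ K) (x : H) (k : ι) :
    b.repr (diagOp b c x) k = c k * b.repr x k := by
  have h : ∃ K : ℝ, 0 ≤ K ∧ ∀ k, ‖c k‖ ≤ K :=
    ⟨max K 0, le_max_right _ _, fun k => (hc k).trans (le_max_left _ _)⟩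
  simp [diagOp, h]

theorem eq_diagOp (hc : ∀ k, ‖c k‖ ≤ K) {R : H →L[ℂ] H}
    (h : ∀ x k, b.repr (R x) k = c k * b.repr x k) : R = diagOp b c := by
  ext x
  refine repr_ext (b := b) fun k => ?_
  rw [h, repr_diagOp hc]

theorem norm_repr_sq (b : HilbertBasis ι ℂ H) (x : H) :
    HasSum (fun k => ‖b.repr x k‖ ^ 2) (‖x‖ ^ 2) := by
  have := lp.hasSum_norm (by simp) (b.repr x)
  simpa using this

theorem norm_le_of_repr {x y : H} (hK : 0 ≤ K) (h : ∀ k, ‖b.repr x k‖ ≤ K * ‖b.repr y k‖) :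
    ‖x‖ ≤ K * ‖y‖ := by
  refine le_of_sq_le_sq ?_ (by positivity)
  rw [mul_pow]
  refine hasSum_le (fun k => ?_) (norm_repr_sq b x) ((norm_repr_sq b y).mul_left (K ^ 2))
  rw [← mul_pow]
  exact pow_le_pow_left₀ (norm_nonneg _) (h k) 2

theorem norm_eq_of_repr {x y : H} (h : ∀ k, ‖b.repr x k‖ = ‖b.repr y k‖) : ‖x‖ = ‖y‖ := by
  refine le_antisymm ?_ ?_
  · simpa using norm_le_of_repr (b := b) (x := x) (y := y) zero_le_one (fun k => by simp [h])
  · simpa using norm_le_of_repr (b := b) (x := y) (y := x) zero_le_one (fun k => by simp [h])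

theorem norm_diagOp_le (hK : 0 ≤ K) (hc : ∀ k, ‖c k‖ ≤ K) : ‖diagOp b c‖ ≤ K := by
  refine ContinuousLinearMap.opNorm_le_bound _ hK fun x => norm_le_of_repr (b := b) hK fun k => ?_
  rw [repr_diagOp hc, norm_mul]
  exact mul_le_mul_of_nonneg_right (hc k) (norm_nonneg _)

theorem diagOp_sub {K' : ℝ} (hc : ∀ k, ‖c k‖ ≤ K) (hd : ∀ k, ‖d k‖ ≤ K') :
    diagOp b c - diagOp b d = diagOp b (fun k => c k - d k) := by
  refine eq_diagOp (K := K + K')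
    (fun k => (norm_sub_le _ _).trans (add_le_add (hc k) (hd k))) fun x k => ?_
  simp [repr_diagOp hc, repr_diagOp hd, sub_mul]

/-- A uniformly continuous family of bounded symbols gives a norm-continuous family of diagonal
operators. -/
theorem continuous_diagOp {X : Type*} [TopologicalSpace X] (b : HilbertBasis ι ℂ H)
    {c : X → ι → ℂ} (hc : ∀ p k, ‖c p k‖ ≤ K)
    (hcont : ∀ p, ∀ ε > 0, ∀ᶠ q in 𝓝 p, ∀ k, ‖c q k - c p k‖ ≤ ε) :
    Continuous fun p => diagOp b (c p) := by
  rw [continuous_iff_continuousAt]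
  intro p
  rw [ContinuousAt, Metric.tendsto_nhds]
  intro ε hε
  filter_upwards [hcont p (ε / 2) (by positivity)] with q hq
  rw [dist_eq_norm, diagOp_sub (hc q) (hc p)]
  exact (norm_diagOp_le (by positivity) hq).trans_lt (by linarith)

/-- `T` is the maximal operator acting on the `k`-th basis vector as multiplication by `μ k`. -/
def IsDiagonal (T : H →ₗ.[ℂ] H) (b : HilbertBasis ι ℂ H) (μ : ι → ℝ) : Prop :=
  ∀ u v, (u, v) ∈ T.graph ↔ ∀ k, b.repr v k = μ k * b.repr u k

variable {T : H →ₗ.[ℂ] H} {μ : ι → ℝ}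

theorem IsDiagonal.repr_apply (hT : IsDiagonal T b μ) (u : T.domain) (k : ι) :
    b.repr (T u) k = μ k * b.repr (u : H) k :=
  (hT _ _).mp (T.mem_graph u) k

theorem IsDiagonal.exists_apply (hT : IsDiagonal T b μ) {u v : H}
    (h : ∀ k, b.repr v k = μ k * b.repr u k) : ∃ hu : u ∈ T.domain, T ⟨u, hu⟩ = v := by
  obtain ⟨y, rfl, h2⟩ := (LinearPMap.mem_graph_iff T).mp ((hT u v).mpr h)
  exact ⟨y.2, h2⟩

theorem IsDiagonal.apply_basis (hT : IsDiagonal T b μ) (k : ι) :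
    ∃ hk : b k ∈ T.domain, T ⟨b k, hk⟩ = (μ k : ℂ) • b k := by
  classical
  refine hT.exists_apply fun j => ?_
  rw [map_smul, lp.coeFn_smul, Pi.smul_apply, b.repr_self, smul_eq_mul]
  rcases eq_or_ne j k with rfl | h
  · rfl
  · simp [h]

theorem IsDiagonal.dense_domain (hT : IsDiagonal T b μ) : Dense (T.domain : Set H) := by
  have h : Submodule.span ℂ (range b) ≤ T.domain := by
    rw [Submodule.span_le]
    rintro _ ⟨k, rfl⟩
    exact (hT.apply_basis k).1
  have h2 := b.dense_span
  rw [← Submodule.dense_iff_topologicalClosure_eq_top] at h2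
  exact h2.mono h

/-- Testing the adjoint relation against the basis vectors determines the coordinates of the
adjoint, and maximality of `T` puts the resulting pair in its graph. The reverse inclusion is
symmetry, which holds because `μ` is real. -/
theorem IsDiagonal.isSelfAdjoint [CompleteSpace H] (hT : IsDiagonal T b μ) :
    IsSelfAdjoint T := by
  have hd := hT.dense_domain
  rw [LinearPMap.isSelfAdjoint_def]
  refine le_antisymm ?_ ?_
  · rw [← LinearPMap.le_graph_iff]
    rintro ⟨u, v⟩ huv
    obtain ⟨y, hy1, hy2⟩ := (LinearPMap.mem_graph_iff _).mp huv
    simp only at hy1 hy2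
    subst hy1 hy2
    rw [hT]
    intro k
    obtain ⟨hk, hTk⟩ := hT.apply_basis k
    have := T.adjoint_isFormalAdjoint hd y ⟨b k, hk⟩
    rw [hTk, inner_smul_right] at this
    rw [b.repr_apply_apply, b.repr_apply_apply, ← inner_conj_symm, this, map_mul, inner_conj_symm]
    simp
  · refine LinearPMap.IsFormalAdjoint.le_adjoint hd fun x y => ?_
    rw [← b.repr.inner_map_map, ← b.repr.inner_map_map, lp.inner_eq_tsum, lp.inner_eq_tsum]
    refine tsum_congr fun k => ?_
    rw [hT.repr_apply, hT.repr_apply]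
    simp
    ring

/-- The inverse is multiplication by `(z - μ k)⁻¹`; the uniform distance `δ`, and not merely `z ≠ μ
k`, makes it bounded. -/
theorem IsDiagonal.mem_resolventSet (hT : IsDiagonal T b μ) {z : ℂ} {δ : ℝ} (hδ : 0 < δ)
    (hz : ∀ k, δ ≤ ‖z - μ k‖) : z ∈ resolventSet T := by
  have hne : ∀ k, z - μ k ≠ 0 := fun k => norm_pos_iff.mp (hδ.trans_le (hz k))
  have hc : ∀ k, ‖(z - μ k)⁻¹‖ ≤ δ⁻¹ := fun k => by
    rw [norm_inv]; exact inv_anti₀ hδ (hz k)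
  have hleft : ∀ u : T.domain, diagOp b (fun k => (z - μ k)⁻¹) (z • (u : H) - T u) = u := by
    intro u
    refine repr_ext (b := b) fun k => ?_
    rw [repr_diagOp hc, map_sub, map_smul]
    simp only [lp.coeFn_sub, lp.coeFn_smul, Pi.sub_apply, Pi.smul_apply, smul_eq_mul,
      hT.repr_apply]
    rw [← sub_mul, inv_mul_cancel_left₀ (hne k)]
  refine ⟨⟨fun u u' h => ?_, fun v => ?_⟩, _, hleft⟩
  · have h' : z • (u : H) - T u = z • (u' : H) - T u' := h
    exact Subtype.ext (by rw [← hleft u, h', hleft u'])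
  · set u := diagOp b (fun k => (z - μ k)⁻¹) v with hu
    -- The equation `z u - T u = v` forces the value `T u = z u - v`.
    obtain ⟨h1, h2⟩ := hT.exists_apply (u := u) (v := z • u - v) fun k => by
      simp only [map_sub, map_smul, lp.coeFn_sub, lp.coeFn_smul, Pi.sub_apply, Pi.smul_apply,
        smul_eq_mul, hu, repr_diagOp hc]
      field_simp [hne k]
      ring
    exact ⟨⟨u, h1⟩, by simp [h2]⟩

theorem IsDiagonal.resolvent_eq (hT : IsDiagonal T b μ) {z : ℂ} {δ : ℝ} (hδ : 0 < δ)
    (hz : ∀ k, δ ≤ ‖z - μ k‖) : resolvent T z = diagOp b (fun k => (z - μ k)⁻¹) := by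
  have hne : ∀ k, z - μ k ≠ 0 := fun k => norm_pos_iff.mp (hδ.trans_le (hz k))
  have hc : ∀ k, ‖(z - μ k)⁻¹‖ ≤ δ⁻¹ := fun k => by
    rw [norm_inv]; exact inv_anti₀ hδ (hz k)
  refine eq_diagOp hc fun v k => ?_
  obtain ⟨h, hv⟩ := resolvent_right (hT.mem_resolventSet hδ hz) v
  conv_rhs => rw [← hv]
  simp only [map_sub, map_smul, lp.coeFn_sub, lp.coeFn_smul, Pi.sub_apply, Pi.smul_apply,
    smul_eq_mul, hT.repr_apply]
  rw [← sub_mul, inv_mul_cancel_left₀ (hne k)]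

theorem IsDiagonal.notMem_resolventSet (hT : IsDiagonal T b μ) (k : ι) :
    (μ k : ℂ) ∉ resolventSet T := by
  intro h
  obtain ⟨hk, hTk⟩ := hT.apply_basis k
  have h0 : (⟨b k, hk⟩ : T.domain) = 0 := h.1.1 (by simp [hTk])
  have h1 : b k = 0 := congrArg Subtype.val h0
  have := b.orthonormal.1 k
  simp [h1] at this

theorem I_add_ofReal_ne_zero (x : ℝ) : (x : ℂ) + Complex.I ≠ 0 := fun h => by
  simpa using congrArg Complex.im h

theorem IsDiagonal.cayley_eq (hT : IsDiagonal T b μ) :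
    cayley T = diagOp b (fun k => (μ k - Complex.I) / (μ k + Complex.I)) := by
  have hz : ∀ k, 1 ≤ ‖-Complex.I - μ k‖ := fun k => by
    simpa using Complex.abs_im_le_norm (-Complex.I - μ k)
  have hc : ∀ k, ‖(-Complex.I - μ k)⁻¹‖ ≤ 1⁻¹ := fun k => by
    rw [norm_inv]; exact inv_anti₀ one_pos (hz k)
  refine eq_diagOp (K := 1) (fun k => le_of_eq ?_) fun x k => ?_
  · have : (μ k - Complex.I : ℂ) = (starRingEnd ℂ) (μ k + Complex.I) := by
      simp [sub_eq_add_neg]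
    rw [norm_div, this, RCLike.norm_conj, div_self]
    exact norm_ne_zero_iff.mpr (I_add_ofReal_ne_zero _)
  · rw [cayley, hT.resolvent_eq one_pos hz]
    simp only [add_apply, smul_apply, one_apply_eq_self, map_add, map_smul, lp.coeFn_add,
      lp.coeFn_smul, Pi.add_apply, Pi.smul_apply, smul_eq_mul, repr_diagOp hc]
    have h1 := I_add_ofReal_ne_zero (μ k)
    have h2 : -Complex.I - μ k ≠ 0 := fun h => h1 (by linear_combination -h)
    field_simp
    ring

theorem IsDiagonal.mem_eigenspace (hT : IsDiagonal T b μ) {z : ℂ} {u : H} :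
    u ∈ eigenspace T z ↔ ∀ k, μ k ≠ z → b.repr u k = 0 := by
  rw [eigenspace, Submodule.mem_map]
  constructor
  · rintro ⟨y, hy, rfl⟩ k hk
    have h1 : z • (y : H) - T y = 0 := hy
    have h2 := congrArg (fun x => b.repr x k) h1
    simp only [map_sub, map_smul, lp.coeFn_sub, lp.coeFn_smul, Pi.sub_apply, Pi.smul_apply,
      smul_eq_mul, hT.repr_apply, ← sub_mul, map_zero, lp.coeFn_zero, Pi.zero_apply,
      mul_eq_zero] at h2
    exact h2.resolve_left (sub_ne_zero.mpr hk.symm)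
  · intro h
    obtain ⟨h1, h2⟩ := hT.exists_apply (u := u) (v := z • u) fun k => by
      simp only [map_smul, lp.coeFn_smul, Pi.smul_apply, smul_eq_mul]
      rcases eq_or_ne (μ k : ℂ) z with hk | hk
      · rw [hk]
      · simp [h k hk]
    exact ⟨⟨u, h1⟩, sub_eq_zero.mpr h2.symm, rfl⟩

theorem mem_span_of_repr_eq_zero (s : Finset ι) {u : H} (h : ∀ k ∉ s, b.repr u k = 0) :
    u ∈ Submodule.span ℂ (b '' s) := by
  have := b.hasSum_repr u
  rw [this.unique (hasSum_sum_of_ne_finset_zero fun k hk => by rw [h k hk, zero_smul])]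
  exact Submodule.sum_mem _ fun k hk =>
    Submodule.smul_mem _ _ (Submodule.subset_span ⟨k, hk, rfl⟩)

theorem finrank_span_basis (b : HilbertBasis ι ℂ H) (s : Finset ι) :
    Module.finrank ℂ (Submodule.span ℂ (b '' s)) = s.card := by
  have h : LinearIndependent ℂ (fun k : s => b k) :=
    b.orthonormal.linearIndependent.comp _ Subtype.val_injective
  rw [image_eq_range]
  simpa using finrank_span_eq_card h

theorem IsDiagonal.eigenspaceSum_eq (hT : IsDiagonal T b μ)
    {x y : ℝ} {s : Finset ι} (hs : ∀ k, k ∈ s ↔ μ k ∈ Icc x y) :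
    eigenspaceSum T x y = Submodule.span ℂ (b '' s) := by
  classical
  refine le_antisymm (iSup₂_le fun r hr u hu => ?_) ?_
  · refine mem_span_of_repr_eq_zero s fun k hk => hT.mem_eigenspace.mp hu k fun h => hk ?_
    rw [hs, Complex.ofReal_injective h]
    exact hr
  · rw [Submodule.span_le]
    rintro _ ⟨k, hk, rfl⟩
    refine Submodule.mem_iSup_of_mem (μ k) (Submodule.mem_iSup_of_mem ((hs k).mp hk) ?_)
    rw [hT.mem_eigenspace]
    intro j hj
    rw [b.repr_self, lp.single_apply_ne]
    rintro rfl
    exact hj rfl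

/-- The kernel lies in the span of the basis vectors indexed by `s`. Inverting `μ` off `s` gives a
bounded parametrix, so this span and the range of `T` together fill `H` and the cokernel is
finite-dimensional. -/
theorem IsDiagonal.isFredholm [CompleteSpace H] (hT : IsDiagonal T b μ) (s : Finset ι) {δ : ℝ}
    (hδ : 0 < δ) (hs : ∀ k ∉ s, δ ≤ |μ k|) : IsFredholm T := by
  classical
  refine ⟨hT.isSelfAdjoint.isClosed, ?_, ?_⟩
  · have : FiniteDimensional ℂ (Submodule.span ℂ (b '' s)) :=
      FiniteDimensional.span_of_finite ℂ (s.finite_toSet.image b)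
    let f : LinearMap.ker T.toFun →ₗ[ℂ] Submodule.span ℂ (b '' s) :=
      LinearMap.codRestrict _ (T.domain.subtype ∘ₗ (LinearMap.ker T.toFun).subtype) fun u => by
        refine mem_span_of_repr_eq_zero s fun k hk => ?_
        have h1 : T u.1 = 0 := u.2
        have h2 := hT.repr_apply u.1 k
        rw [h1, map_zero] at h2
        have h3 := hs k hk
        have h4 : (μ k : ℂ) ≠ 0 := by
          rw [Complex.ofReal_ne_zero, ← abs_pos]; linarith
        simpa [h4] using h2.symm
    refine FiniteDimensional.of_injective f fun x y h => ?_
    have := congrArg Subtype.val h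
    exact Subtype.ext (Subtype.ext this)
  · let c : ι → ℂ := fun k => if k ∈ s then 0 else (μ k : ℂ)⁻¹
    have hc : ∀ k, ‖c k‖ ≤ δ⁻¹ := fun k => by
      by_cases hk : k ∈ s
      · simp [c, hk, hδ.le]
      · simp only [c, hk, if_false, norm_inv, Complex.norm_real, Real.norm_eq_abs]
        exact inv_anti₀ hδ (hs k hk)
    have hsup : Submodule.span ℂ (b '' s) ⊔ LinearMap.range T.toFun = ⊤ := by
      rw [eq_top_iff]
      intro v _
      let c₀ : ι → ℂ := fun k => if k ∈ s then 0 else 1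
      have hc₀ : ∀ k, ‖c₀ k‖ ≤ 1 := fun k => by by_cases hk : k ∈ s <;> simp [c₀, hk]
      obtain ⟨h1, h2⟩ := hT.exists_apply (u := diagOp b c v) (v := diagOp b c₀ v) fun k => by
        rw [repr_diagOp hc, repr_diagOp hc₀]
        by_cases hk : k ∈ s
        · simp [c, c₀, hk]
        · have h3 := hs k hk
          have h4 : (μ k : ℂ) ≠ 0 := by
            rw [Complex.ofReal_ne_zero, ← abs_pos]; linarith
          simp [c, c₀, hk, h4]
      rw [← sub_add_cancel v (diagOp b c₀ v)]
      refine Submodule.add_mem_sup (mem_span_of_repr_eq_zero s fun k hk => ?_)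
        ⟨⟨diagOp b c v, h1⟩, h2⟩
      simp [repr_diagOp hc₀, c₀, hk]
    have : FiniteDimensional ℂ (Submodule.span ℂ (b '' s)) :=
      FiniteDimensional.span_of_finite ℂ (s.finite_toSet.image b)
    let g := (LinearMap.range T.toFun).mkQ ∘ₗ (Submodule.span ℂ (b '' s)).subtype
    refine FiniteDimensional.of_surjective g fun q => ?_
    obtain ⟨v, rfl⟩ := Submodule.mkQ_surjective _ q
    obtain ⟨x, hx, y, hy, rfl⟩ := Submodule.mem_sup.mp (hsup ▸ Submodule.mem_top : v ∈ _)
    refine ⟨⟨x, hx⟩, ?_⟩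
    have : (LinearMap.range T.toFun).mkQ y = 0 := (Submodule.Quotient.mk_eq_zero _).mpr hy
    rw [map_add, this, add_zero]
    rfl

end Diagonal

/-! ### The spectral projection of a diagonal operator -/

section DiagonalProjection

variable {ι : Type*} {H : Type*} [NormedAddCommGroup H] [InnerProductSpace ℂ H]
variable {b : HilbertBasis ι ℂ H} {T : H →ₗ.[ℂ] H} {μ : ι → ℝ}

theorem le_norm_sub_of_mem_sphere {r δ x : ℝ} (h : δ ≤ |(|x| - r)|) {z : ℂ}
    (hz : z ∈ Metric.sphere (0 : ℂ) r) : δ ≤ ‖z - x‖ := by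
  refine h.trans ?_
  have h1 := abs_norm_sub_norm_le z (x : ℂ)
  rw [mem_sphere_zero_iff_norm] at hz
  rwa [hz, Complex.norm_real, Real.norm_eq_abs, abs_sub_comm] at h1

/-- This is the winding number of the circle about `x`: Cauchy's formula inside, Cauchy's theorem
outside. -/
theorem circleIntegral_inv_sub_ofReal {r x : ℝ} (hr : 0 < r) (hx : |x| ≠ r) :
    (2 * (Real.pi : ℂ) * Complex.I)⁻¹ * ∮ z in C(0, r), (z - x)⁻¹ =
      if |x| < r then 1 else 0 := by
  split_ifs with h
  · rw [circleIntegral.integral_sub_inv_of_mem_ball (by simpa using h), inv_mul_cancel₀]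
    simp [Real.pi_ne_zero]
  · have hne : ∀ z ∈ Metric.closedBall (0 : ℂ) r, z - x ≠ 0 := by
      intro z hz h0
      rw [sub_eq_zero.mp h0] at hz
      simp only [mem_closedBall_zero_iff, Complex.norm_real, Real.norm_eq_abs] at hz
      exact h (lt_of_le_of_ne hz hx)
    rw [Complex.circleIntegral_eq_zero_of_differentiable_on_off_countable hr.le countable_empty,
      mul_zero]
    · exact (continuousOn_id.sub continuousOn_const).inv₀ hne
    · intro z hz
      exact (differentiableAt_id.sub_const _).inv (hne z (Metric.ball_subset_closedBall hz.1))

theorem IsDiagonal.spectralProjection_eq [CompleteSpace H] (hT : IsDiagonal T b μ) {r δ : ℝ} (hr : 0 < r)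
    (hδ : 0 < δ) (h : ∀ k, δ ≤ |(|μ k| - r)|) :
    spectralProjection T (-r) r = diagOp b (fun k => if |μ k| < r then 1 else 0) := by
  have hz : ∀ z ∈ Metric.sphere (0 : ℂ) r, ∀ k, δ ≤ ‖z - μ k‖ := fun z hz k =>
    le_norm_sub_of_mem_sphere (h k) hz
  have hc : ∀ z : Metric.sphere (0 : ℂ) r, ∀ k, ‖((z : ℂ) - μ k)⁻¹‖ ≤ δ⁻¹ := fun z k => by
    rw [norm_inv]; exact inv_anti₀ hδ (hz z z.2 k)
  have hcont : ContinuousOn (fun z => resolvent T z) (Metric.sphere (0 : ℂ) r) := by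
    rw [continuousOn_iff_continuous_domRestrict]
    have e : (Metric.sphere (0 : ℂ) r).domRestrict (fun z => resolvent T z) =
        fun z : Metric.sphere (0 : ℂ) r => diagOp b (fun k => ((z : ℂ) - μ k)⁻¹) := by
      ext1 z
      exact hT.resolvent_eq hδ (hz z z.2)
    rw [e]
    refine continuous_diagOp b hc fun p ε hε => ?_
    -- Both denominators have modulus at least `δ`, so the symbols at `p` and `q` differ by at most
    -- `dist q p / δ ^ 2`, uniformly in `k`.
    have : ∀ᶠ q in 𝓝 p, dist q p < ε * δ ^ 2 := Metric.ball_mem_nhds p (by positivity)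
    filter_upwards [this] with q hq k
    have hne : ∀ z : Metric.sphere (0 : ℂ) r, (z : ℂ) - μ k ≠ 0 := fun z =>
      norm_pos_iff.mp (hδ.trans_le (hz z z.2 k))
    rw [inv_sub_inv (hne q) (hne p), norm_div, norm_mul]
    rw [div_le_iff₀ (mul_pos (norm_pos_iff.mpr (hne q)) (norm_pos_iff.mpr (hne p)))]
    have h1 : ‖(p : ℂ) - μ k - (q - μ k)‖ < ε * δ ^ 2 := by
      rw [sub_sub_sub_cancel_right, ← dist_eq_norm, dist_comm]
      exact hq
    have h2 : δ ^ 2 ≤ ‖(q : ℂ) - μ k‖ * ‖(p : ℂ) - μ k‖ := by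
      rw [sq]; exact mul_le_mul (hz q q.2 k) (hz p p.2 k) hδ.le (norm_nonneg _)
    exact h1.le.trans (mul_le_mul_of_nonneg_left h2 hε.le)
  refine eq_diagOp (K := 1) (fun k => by split_ifs <;> simp) fun x k => ?_
  have hint := (hcont.circleIntegrable hr.le).out
  -- Taking one coordinate of `R x` is continuous and linear in `R`, so it passes under the integral
  -- and leaves a scalar contour integral.
  let L : (H →L[ℂ] H) →L[ℂ] ℂ :=
    (lp.evalCLM ℂ (fun _ : ι => ℂ) 2 k) ∘L (b.repr.toContinuousLinearEquiv : H →L[ℂ] _) ∘L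
      ContinuousLinearMap.apply ℂ H x
  have hL : ∀ R : H →L[ℂ] H, L R = b.repr (R x) k := fun R => rfl
  rw [spectralProjection, ← hL, map_smul]
  have e1 : (((-r + r) / 2 : ℝ) : ℂ) = 0 := by simp
  have e2 : (r - -r) / 2 = r := by ring
  rw [e1, e2, circleIntegral, ← L.intervalIntegral_comp_comm hint]
  have e3 : ∀ θ : ℝ, L (deriv (circleMap 0 r) θ • resolvent T (circleMap 0 r θ)) =
      (deriv (circleMap 0 r) θ • (circleMap 0 r θ - μ k)⁻¹) * b.repr x k := by
    intro θ
    have hm : circleMap 0 r θ ∈ Metric.sphere (0 : ℂ) r := circleMap_mem_sphere _ hr.le _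
    rw [map_smul, hL, hT.resolvent_eq hδ (hz _ hm), repr_diagOp (hc ⟨_, hm⟩), smul_mul_assoc]
  simp_rw [e3]
  rw [intervalIntegral.integral_mul_const, smul_eq_mul, ← mul_assoc]
  congr 1
  refine circleIntegral_inv_sub_ofReal hr fun h0 => ?_
  have := h k
  rw [h0, sub_self, abs_zero] at this
  linarith

theorem range_diagOp_indicator (b : HilbertBasis ι ℂ H) (s : Finset ι) {p : ι → Prop}
    [DecidablePred p] (hs : ∀ k, k ∈ s ↔ p k) :
    LinearMap.range (diagOp b (fun k => if p k then 1 else 0) : H →ₗ[ℂ] H) =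
      Submodule.span ℂ (b '' s) := by
  classical
  have hc : ∀ k, ‖(if p k then 1 else 0 : ℂ)‖ ≤ 1 := fun k => by split_ifs <;> simp
  refine le_antisymm ?_ ?_
  · rintro _ ⟨x, rfl⟩
    refine mem_span_of_repr_eq_zero s fun k hk => ?_
    rw [hs] at hk
    simp [repr_diagOp hc, hk]
  · rw [Submodule.span_le]
    rintro _ ⟨k, hk, rfl⟩
    refine ⟨b k, repr_ext (b := b) fun j => ?_⟩
    have hk' := (hs k).mp hk
    rw [ContinuousLinearMap.coe_coe, repr_diagOp hc, b.repr_self]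
    rcases eq_or_ne j k with rfl | h
    · simp [hk']
    · simp [h]

end DiagonalProjection

/-! ### The exponential basis of `L²[0, 1]` -/

section Exponentials

theorem norm_exp_I_mul (ν t : ℝ) : ‖Complex.exp (Complex.I * ν * t)‖ = 1 := by
  rw [mul_assoc, mul_comm, ← Complex.ofReal_mul, Complex.norm_exp_ofReal_mul_I]

theorem integral_volI (f : ℝ → ℂ) : ∫ t, f t ∂volI = ∫ t in (0 : ℝ)..1, f t := by
  rw [volI, integral_Icc_eq_integral_Ioc, intervalIntegral.integral_of_le zero_le_one]

theorem memLp_exp (ν : ℝ) (p : ℝ≥0∞) :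
    MemLp (fun t : ℝ => Complex.exp (Complex.I * ν * t)) p volI :=
  MemLp.of_bound (by fun_prop) 1 (Filter.Eventually.of_forall fun t => (norm_exp_I_mul ν t).le)

/-- The function `t ↦ e^{iνt}` as an element of `Lᵖ[0, 1]`. -/
def expLp (p : ℝ≥0∞) (ν : ℝ) : Lp ℂ p volI := (memLp_exp ν p).toLp _

theorem coeFn_expLp (p : ℝ≥0∞) (ν : ℝ) :
    expLp p ν =ᵐ[volI] fun t => Complex.exp (Complex.I * ν * t) := MemLp.coeFn_toLp _

/-- Multiplication by `t ↦ e^{iνt}` on `L²[0, 1]`. -/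
def expMul (ν : ℝ) : L2I →L[ℂ] L2I :=
  (ContinuousLinearMap.mul ℂ ℂ).holderL volI ∞ 2 2 (expLp ∞ ν)

theorem coeFn_expMul (ν : ℝ) (u : L2I) :
    expMul ν u =ᵐ[volI] fun t => Complex.exp (Complex.I * ν * t) * u t := by
  have h : expMul ν u =ᵐ[volI] fun t => (expLp ∞ ν) t * u t :=
    (ContinuousLinearMap.mul ℂ ℂ).coeFn_holder (r := 2) (expLp ∞ ν) u
  filter_upwards [h, coeFn_expLp ∞ ν] with t h1 h2
  rw [h1, h2]

/-- On the bounded interval, `|e^{iνt} - e^{iν't}| ≤ |ν - ν'| t ≤ |ν - ν'|`, so the multipliers are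
`1`-Lipschitz in the sup norm. -/
theorem continuous_expMul : Continuous expMul := by
  refine ((ContinuousLinearMap.mul ℂ ℂ).holderL volI ∞ 2 2).continuous.comp ?_
  refine (LipschitzWith.of_dist_le_mul (K := 1) fun ν ν' => ?_).continuous
  rw [dist_eq_norm, NNReal.coe_one, one_mul]
  have := Lp.norm_le_of_ae_bound (f := expLp ∞ ν - expLp ∞ ν') (dist_nonneg (x := ν) (y := ν')) (by
    filter_upwards [Lp.coeFn_sub (expLp ∞ ν) (expLp ∞ ν'), coeFn_expLp ∞ ν, coeFn_expLp ∞ ν',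
      ae_restrict_mem measurableSet_Icc] with t h1 h2 h3 ht
    rw [h1, Pi.sub_apply, h2, h3]
    have e : Complex.exp (Complex.I * ν * t) - Complex.exp (Complex.I * ν' * t) =
        Complex.exp (Complex.I * ν' * t) *
          (Complex.exp (Complex.I * ((ν - ν') * t : ℝ)) - 1) := by
      rw [mul_sub, ← Complex.exp_add, mul_one]
      congr 2
      push_cast; ring
    rw [e, norm_mul, norm_exp_I_mul, one_mul]
    refine (Real.norm_exp_I_mul_ofReal_sub_one_le).trans ?_
    rw [norm_mul, Real.norm_eq_abs, Real.dist_eq, Real.norm_eq_abs, abs_of_nonneg ht.1]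
    exact mul_le_of_le_one_right (abs_nonneg _) ht.2)
  simpa using this

theorem expMul_expMul (ν ν' : ℝ) (u : L2I) : expMul ν (expMul ν' u) = expMul (ν + ν') u := by
  refine Lp.ext ?_
  filter_upwards [coeFn_expMul ν (expMul ν' u), coeFn_expMul ν' u, coeFn_expMul (ν + ν') u]
    with t h1 h2 h3
  rw [h1, h2, h3, ← mul_assoc, ← Complex.exp_add]
  congr 2
  push_cast; ring

theorem expMul_zero (u : L2I) : expMul 0 u = u := by
  refine Lp.ext ?_
  filter_upwards [coeFn_expMul 0 u] with t h1
  simp [h1]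

theorem norm_expMul (ν : ℝ) (u : L2I) : ‖expMul ν u‖ = ‖u‖ := by
  have h : ∀ᵐ t ∂volI, ‖expMul ν u t‖ = ‖u t‖ := by
    filter_upwards [coeFn_expMul ν u] with t h1
    rw [h1, norm_mul, norm_exp_I_mul, one_mul]
  exact le_antisymm (Lp.norm_le_norm_of_ae_le (h.mono fun t ht => ht.le))
    (Lp.norm_le_norm_of_ae_le (h.mono fun t ht => ht.ge))

theorem expMul_expLp (ν ν' : ℝ) : expMul ν (expLp 2 ν') = expLp 2 (ν + ν') := by
  refine Lp.ext ?_
  filter_upwards [coeFn_expMul ν (expLp 2 ν'), coeFn_expLp 2 ν', coeFn_expLp 2 (ν + ν')]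
    with t h1 h2 h3
  rw [h1, h2, h3, ← Complex.exp_add]
  congr 1
  push_cast; ring

/-- Multiplication by `t ↦ e^{iνt}` as a unitary operator. -/
def expEquiv (ν : ℝ) : L2I ≃ₗᵢ[ℂ] L2I where
  toLinearEquiv := LinearEquiv.ofLinearMap (expMul ν : L2I →ₗ[ℂ] L2I) (expMul (-ν) : L2I →ₗ[ℂ] L2I)
    (by ext1 u; simp [expMul_expMul, expMul_zero]) (by ext1 u; simp [expMul_expMul, expMul_zero])
  norm_map' := norm_expMul ν

theorem inner_expLp (ν : ℝ) (u : L2I) :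
    inner ℂ (expLp 2 ν) u = ∫ t in (0 : ℝ)..1, Complex.exp (-(Complex.I * ν * t)) * u t := by
  rw [L2.inner_def, ← integral_volI]
  refine integral_congr_ae ?_
  filter_upwards [coeFn_expLp 2 ν] with t h
  rw [h, RCLike.inner_apply', ← Complex.exp_conj]
  simp

theorem orthonormal_expLp : Orthonormal ℂ (fun k : ℤ => expLp 2 (2 * Real.pi * k)) := by
  classical
  rw [orthonormal_iff_ite]
  intro j k
  rw [inner_expLp]
  have h : ∫ t in (0 : ℝ)..1, Complex.exp (-(Complex.I * ↑(2 * Real.pi * j) * t)) *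
      expLp 2 (2 * Real.pi * k) t =
      ∫ t in (0 : ℝ)..1, Complex.exp ((2 * Real.pi * (k - j) * Complex.I : ℂ) * t) := by
    rw [← integral_volI, ← integral_volI]
    refine integral_congr_ae ?_
    filter_upwards [coeFn_expLp 2 (2 * Real.pi * k)] with t h
    rw [h, ← Complex.exp_add]
    congr 1
    push_cast; ring
  rw [h]
  split_ifs with hjk
  · simp [hjk]
  · have hne : (2 * Real.pi * (k - j) * Complex.I : ℂ) ≠ 0 := by
      have : (k : ℂ) - j ≠ 0 := by
        rw [sub_ne_zero]; exact_mod_cast (Ne.symm hjk)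
      simp [Real.pi_ne_zero, this]
    rw [integral_exp_mul_complex hne]
    have : Complex.exp (2 * Real.pi * (k - j) * Complex.I * (1 : ℝ)) = 1 := by
      rw [Complex.exp_eq_one_iff]
      exact ⟨k - j, by push_cast; ring⟩
    rw [this]
    simp

/-- By Parseval, a function all of whose Fourier coefficients vanish has zero `L²` norm. -/
theorem span_expLp_orthogonal :
    (Submodule.span ℂ (range fun k : ℤ => expLp 2 (2 * Real.pi * k)))ᗮ = ⊥ := by
  rw [Submodule.eq_bot_iff]
  intro u hu
  have h0 : ∀ k : ℤ, inner ℂ (expLp 2 (2 * Real.pi * k)) u = 0 := fun k =>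
    (Submodule.mem_orthogonal _ _).mp hu _ (Submodule.subset_span ⟨k, rfl⟩)
  have hmem : MemLp (u : ℝ → ℂ) 2 (volume.restrict (Ioc 0 1)) := by
    rw [restrict_Ioc_eq_restrict_Icc]; exact Lp.memLp u
  have hsum := hasSum_sq_fourierCoeffOn zero_lt_one hmem
  have hco : ∀ k : ℤ, fourierCoeffOn zero_lt_one (u : ℝ → ℂ) k = 0 := by
    intro k
    have e : fourierCoeffOn zero_lt_one (u : ℝ → ℂ) k =
        (1 / (1 - 0) : ℝ) • inner ℂ (expLp 2 (2 * Real.pi * k)) u := by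
      rw [fourierCoeffOn_eq_integral, inner_expLp]
      congr 1
      refine intervalIntegral.integral_congr fun t _ => ?_
      simp only [fourier_coe_apply, smul_eq_mul]
      congr 2
      push_cast; ring
    rw [e, h0, smul_zero]
  simp only [hco, norm_zero, ne_eq, OfNat.ofNat_ne_zero, not_false_eq_true, zero_pow] at hsum
  have h1 : ∫ t in (0 : ℝ)..1, ‖u t‖ ^ 2 = 0 := by
    simpa using (hasSum_zero.unique hsum).symm
  have h2 : inner ℂ u u = 0 := by
    rw [L2.inner_def, integral_volI]
    have : ∀ t, inner ℂ (u t) (u t) = ((‖u t‖ ^ 2 : ℝ) : ℂ) := fun t => by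
      rw [inner_self_eq_norm_sq_to_K]; norm_cast
    simp_rw [this]
    rw [intervalIntegral.integral_ofReal, h1, Complex.ofReal_zero]
  exact inner_self_eq_zero.mp h2

/-- The Fourier basis of `L²[0, 1]`. -/
def fourierBasisI : HilbertBasis ℤ ℂ L2I :=
  HilbertBasis.mkOfOrthogonalEqBot orthonormal_expLp span_expLp_orthogonal

/-- The Hilbert basis `t ↦ e^{i(2πk - θ)t}` of `L²[0, 1]`. -/
def twistedBasis (θ : ℝ) : HilbertBasis ℤ ℂ L2I :=
  HilbertBasis.ofRepr ((expEquiv (-θ)).symm.trans fourierBasisI.repr)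

theorem twistedBasis_apply (θ : ℝ) (k : ℤ) :
    twistedBasis θ k = expLp 2 (2 * Real.pi * k - θ) := by
  classical
  rw [← (twistedBasis θ).repr_symm_single]
  have : (twistedBasis θ).repr.symm (lp.single 2 k 1) =
      expMul (-θ) (fourierBasisI.repr.symm (lp.single 2 k 1)) := rfl
  rw [this, fourierBasisI.repr_symm_single, fourierBasisI,
    HilbertBasis.coe_mkOfOrthogonalEqBot, expMul_expLp]
  congr 1
  ring

/-- Conjugation by a multiplication operator replaces the moving basis by a fixed one, so dependence
on `θ` can be controlled through `expMul`. -/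
theorem diagOp_twistedBasis (θ : ℝ) {c : ℤ → ℂ} {K : ℝ} (hc : ∀ k, ‖c k‖ ≤ K) :
    diagOp (twistedBasis θ) c = expMul (-θ) ∘L diagOp fourierBasisI c ∘L expMul θ := by
  symm
  refine eq_diagOp hc fun x k => ?_
  have h1 : ∀ y, (twistedBasis θ).repr (expMul (-θ) y) = fourierBasisI.repr y := fun y => by
    have : (twistedBasis θ).repr (expMul (-θ) y) =
      fourierBasisI.repr ((expEquiv (-θ)).symm (expEquiv (-θ) y)) := rfl
    rw [this, LinearIsometryEquiv.symm_apply_apply]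
  have h2 : fourierBasisI.repr (expMul θ x) = (twistedBasis θ).repr x := by
    rw [← h1, expMul_expMul, neg_add_cancel, expMul_zero]
  simp only [ContinuousLinearMap.comp_apply]
  rw [h1, repr_diagOp hc, h2]

/-- A jointly uniformly continuous family of bounded symbols gives a norm-continuous family of
operators, diagonal in the moving bases `twistedBasis θ`. -/
theorem continuous_diagOp_twistedBasis {X : Type*} [TopologicalSpace X] {θ : X → ℝ}
    (hθ : Continuous θ) {c : X → ℤ → ℂ} {K : ℝ} (hc : ∀ p k, ‖c p k‖ ≤ K)
    (hcont : ∀ p, ∀ ε > 0, ∀ᶠ q in 𝓝 p, ∀ k, ‖c q k - c p k‖ ≤ ε) :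
    Continuous fun p => diagOp (twistedBasis (θ p)) (c p) := by
  simp_rw [fun p => diagOp_twistedBasis (θ p) (hc p)]
  exact (continuous_expMul.comp hθ.neg).clm_comp
    ((continuous_diagOp _ hc hcont).clm_comp (continuous_expMul.comp hθ))

end Exponentials

/-! ### Complex valued absolutely continuous functions -/

section AbsolutelyContinuous

theorem absolutelyContinuousOnInterval_const {X : Type*} [PseudoMetricSpace X] (c : X) (a b : ℝ) :
    AbsolutelyContinuousOnInterval (fun _ => c) a b :=
  ((LipschitzWith.const c).lipschitzOnWith (s := uIcc a b)).absolutelyContinuousOnInterval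

theorem absolutelyContinuousOnInterval_integral_complex {f : ℝ → ℂ} {a b : ℝ}
    (h : IntervalIntegrable f volume a b) :
    AbsolutelyContinuousOnInterval (fun x => ∫ t in a..x, f t) a b := by
  have hre : IntervalIntegrable (fun t => (f t).re) volume a b := ⟨h.1.re, h.2.re⟩
  have him : IntervalIntegrable (fun t => (f t).im) volume a b := ⟨h.1.im, h.2.im⟩
  have h1 := (hre.absolutelyContinuousOnInterval_intervalIntegral left_mem_uIcc).smul
    (absolutelyContinuousOnInterval_const (1 : ℂ) a b)
  have h2 := (him.absolutelyContinuousOnInterval_intervalIntegral left_mem_uIcc).smul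
    (absolutelyContinuousOnInterval_const Complex.I a b)
  have h3 := h1.add h2
  have e : EqOn (fun x => ∫ t in a..x, f t)
      ((fun x => ∫ t in a..x, (f t).re) • (fun _ => (1 : ℂ)) +
        (fun x => ∫ t in a..x, (f t).im) • fun _ => Complex.I) (uIcc a b) := by
    intro x hx
    have hsub : uIcc a x ⊆ uIcc a b := uIcc_subset_uIcc left_mem_uIcc hx
    simp only [Pi.add_apply, Pi.smul_apply', Complex.real_smul, mul_one]
    rw [← intervalIntegral.integral_ofReal, ← intervalIntegral.integral_ofReal,
      ← intervalIntegral.integral_mul_const, ← intervalIntegral.integral_add]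
    · simp_rw [Complex.re_add_im]
    · exact ⟨Complex.ofRealCLM.integrable_comp (hre.mono_set hsub).1,
        Complex.ofRealCLM.integrable_comp (hre.mono_set hsub).2⟩
    · refine IntervalIntegrable.mul_const ?_ _
      exact ⟨Complex.ofRealCLM.integrable_comp (him.mono_set hsub).1,
        Complex.ofRealCLM.integrable_comp (him.mono_set hsub).2⟩
  -- Absolute continuity only sees values on the interval, so the agreement `e` of the two functions
  -- there is enough.
  rw [absolutelyContinuousOnInterval_iff] at h3 ⊢
  intro ε hε
  obtain ⟨δ, hδ, h4⟩ := h3 ε hε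
  refine ⟨δ, hδ, fun E hE hlt => ?_⟩
  have h5 := h4 E hE hlt
  exact lt_of_eq_of_lt (Finset.sum_congr rfl fun i hi =>
    congrArg₂ dist (e (hE.1 i hi).1) (e (hE.1 i hi).2)) h5

theorem ae_volI_of_ae {p : ℝ → Prop} (h : ∀ᵐ x, x ∈ uIcc (0 : ℝ) 1 → p x) : ∀ᵐ x ∂volI, p x := by
  rw [uIcc_of_le zero_le_one] at h
  exact (ae_restrict_iff' measurableSet_Icc).mpr h

theorem intervalIntegrable_of_memLp {f : ℝ → ℂ} (hf : MemLp f 2 volI) :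
    IntervalIntegrable f volume 0 1 := by
  rw [intervalIntegrable_iff_integrableOn_Icc_of_le zero_le_one]
  exact hf.integrable (by norm_num)

/-- Subtracting from `f` the integral of its derivative leaves an absolutely continuous function
with derivative zero almost everywhere, hence a constant. -/
theorem integral_deriv_of_ac {f : ℝ → ℂ} (hf : AbsolutelyContinuousOnInterval f 0 1)
    (hint : IntervalIntegrable (deriv f) volume 0 1) :
    ∫ t in (0 : ℝ)..1, deriv f t = f 1 - f 0 := by
  have hac : AbsolutelyContinuousOnInterval (fun x => f x - ∫ t in (0 : ℝ)..x, deriv f t) 0 1 :=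
    hf.sub (absolutelyContinuousOnInterval_integral_complex hint)
  have hd : ∀ᵐ x, x ∈ uIcc (0 : ℝ) 1 →
      HasDerivAt (fun x => f x - ∫ t in (0 : ℝ)..x, deriv f t) 0 x := by
    have h1 := (ae_restrict_iff' measurableSet_Icc).mp (ae_differentiableAt_of_ac hf)
    rw [← uIcc_of_le zero_le_one] at h1
    filter_upwards [h1, hint.ae_hasDerivAt_integral] with x hx1 hx2 hx
    simpa using (hx1 hx).hasDerivAt.fun_sub (hx2 hx 0 left_mem_uIcc)
  obtain ⟨C, hC⟩ := hac.const_of_ae_hasDerivAt_zero hd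
  have h0 := hC 0 left_mem_uIcc
  have h1 := hC 1 right_mem_uIcc
  simp only [intervalIntegral.integral_same, sub_zero] at h0
  rw [h0, ← h1]
  ring

theorem ac_exp_mul (z : ℂ) (a b : ℝ) :
    AbsolutelyContinuousOnInterval (fun t : ℝ => Complex.exp (z * t)) a b := by
  refine ContDiffOn.absolutelyContinuousOnInterval (ContDiff.contDiffOn ?_)
  exact (contDiff_const.mul Complex.ofRealCLM.contDiff).cexp

theorem hasDerivAt_exp_mul (z : ℂ) (t : ℝ) :
    HasDerivAt (fun t : ℝ => Complex.exp (z * t)) (Complex.exp (z * t) * z) t := by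
  have := ((Complex.ofRealCLM.hasDerivAt (x := t)).const_mul z).cexp
  simpa using this

end AbsolutelyContinuous

/-! ### Diagonalisation of the operators `i d/dt` -/

section TwistedOperator

theorem coeFn_twistedOperator {θ : ℝ} (u : (twistedOperator θ).domain) {f : ℝ → ℂ}
    (hf : IsTwistedH1 θ f) (huf : (u : L2I) =ᵐ[volI] f) :
    twistedOperator θ u =ᵐ[volI] fun t => Complex.I * deriv f t := by
  have h1 : twistedOperator θ u = Complex.I • twistedDeriv θ u := rfl
  rw [h1]
  filter_upwards [Lp.coeFn_smul Complex.I (twistedDeriv θ u), twistedDeriv_eq u hf huf]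
    with t h2 h3
  rw [h2, Pi.smul_apply, h3, smul_eq_mul]

theorem exp_twist (θ : ℝ) (k : ℤ) :
    Complex.exp (-(Complex.I * (2 * Real.pi * k - θ))) = Complex.exp (Complex.I * θ) := by
  rw [Complex.exp_eq_exp_iff_exists_int]
  exact ⟨-k, by push_cast; ring⟩

/-- Integration by parts: the product of the conjugate exponential with a representative of `u`
takes the same value at `0` and `1`, because the two twists cancel. -/
theorem inner_expLp_twistedOperator {θ : ℝ} (k : ℤ) (u : (twistedOperator θ).domain) :
    inner ℂ (expLp 2 (2 * Real.pi * k - θ)) (twistedOperator θ u) =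
      (θ - 2 * Real.pi * k) * inner ℂ (expLp 2 (2 * Real.pi * k - θ)) (u : L2I) := by
  obtain ⟨f, hf, huf⟩ := u.2
  set ν : ℂ := Complex.I * (2 * Real.pi * k - θ) with hν
  have hν' : Complex.I * ((2 * Real.pi * k - θ : ℝ) : ℂ) = ν := by rw [hν]; push_cast; ring
  have e1 : inner ℂ (expLp 2 (2 * Real.pi * k - θ)) (u : L2I) =
      ∫ t in (0 : ℝ)..1, Complex.exp (-ν * t) * f t := by
    rw [inner_expLp, ← integral_volI, ← integral_volI, hν']
    refine integral_congr_ae ?_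
    filter_upwards [huf] with t ht
    rw [ht, neg_mul]
  have e2 : inner ℂ (expLp 2 (2 * Real.pi * k - θ)) (twistedOperator θ u) =
      Complex.I * ∫ t in (0 : ℝ)..1, Complex.exp (-ν * t) * deriv f t := by
    rw [inner_expLp, ← integral_volI, ← integral_volI, hν', ← integral_const_mul]
    refine integral_congr_ae ?_
    filter_upwards [coeFn_twistedOperator u hf huf] with t ht
    rw [ht, neg_mul]
    ring
  have hdf := intervalIntegrable_of_memLp hf.2.1
  have hexp : ContinuousOn (fun t : ℝ => Complex.exp (-ν * t)) (uIcc 0 1) := by fun_prop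
  have hI1 : IntervalIntegrable (fun t : ℝ => Complex.exp (-ν * t) * deriv f t) volume 0 1 :=
    hdf.continuousOn_mul hexp
  have hI2 : IntervalIntegrable (fun t : ℝ => Complex.exp (-ν * t) * f t) volume 0 1 :=
    (hexp.mul hf.1.continuousOn).intervalIntegrable
  have hac : AbsolutelyContinuousOnInterval (fun t : ℝ => Complex.exp (-ν * t) * f t) 0 1 :=
    (ac_exp_mul (-ν) 0 1).smul hf.1
  have hderiv : deriv (fun t : ℝ => Complex.exp (-ν * t) * f t) =ᵐ[volI]
      fun t => Complex.exp (-ν * t) * deriv f t - ν * (Complex.exp (-ν * t) * f t) := by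
    filter_upwards [ae_differentiableAt_of_ac hf.1] with t ht
    rw [((hasDerivAt_exp_mul (-ν) t).fun_mul ht.hasDerivAt).deriv]
    ring
  have hI3 := hI1.sub (hI2.const_mul ν)
  have hderiv' : deriv (fun t : ℝ => Complex.exp (-ν * t) * f t) =ᵐ[volume.restrict (uIoc 0 1)]
      fun t => Complex.exp (-ν * t) * deriv f t - ν * (Complex.exp (-ν * t) * f t) := by
    rw [uIoc_of_le zero_le_one, restrict_Ioc_eq_restrict_Icc]
    exact hderiv
  have key := integral_deriv_of_ac hac (hI3.congr_ae hderiv'.symm)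
  rw [intervalIntegral.integral_congr_ae_restrict hderiv', intervalIntegral.integral_sub hI1
    (hI2.const_mul ν), intervalIntegral.integral_const_mul] at key
  have hb : Complex.exp (-ν * (1 : ℝ)) * f 1 - Complex.exp (-ν * (0 : ℝ)) * f 0 = 0 := by
    rw [hf.2.2, Complex.ofReal_one, mul_one, hν, exp_twist]
    simp
  rw [hb, sub_eq_zero] at key
  rw [e1, e2, key, hν]
  linear_combination (2 * Real.pi * k - θ) * (∫ t in (0 : ℝ)..1,
    Complex.exp (-(Complex.I * (2 * Real.pi * k - θ)) * t) * f t) * Complex.I_sq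

/-- The equation reads `w' = -w + i v`, solved by variation of constants. It supplies the maximality
of the domain in `isDiagonal_twistedOperator`. -/
theorem exists_twistedOperator_solution (θ : ℝ) (v : L2I) :
    ∃ w : (twistedOperator θ).domain, (-Complex.I) • (w : L2I) - twistedOperator θ w = v := by
  have hv := intervalIntegrable_of_memLp (Lp.memLp v)
  have hg : IntervalIntegrable (fun s : ℝ => Complex.exp (1 * s) * v s) volume 0 1 :=
    hv.continuousOn_mul (by fun_prop)
  set J : ℝ → ℂ := fun t => ∫ s in (0 : ℝ)..t, Complex.exp (1 * s) * v s with hJ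
  have hJac : AbsolutelyContinuousOnInterval J 0 1 :=
    absolutelyContinuousOnInterval_integral_complex hg
  have hq : 1 - Complex.exp (Complex.I * θ) * Complex.exp (-1) ≠ 0 := by
    intro h
    have h1 : Complex.exp (Complex.I * θ) * Complex.exp (-1) = 1 := (sub_eq_zero.mp h).symm
    have h2 := congrArg norm h1
    rw [norm_mul, mul_comm Complex.I, Complex.norm_exp_ofReal_mul_I, one_mul, Complex.norm_exp,
      norm_one, Real.exp_eq_one_iff] at h2
    simp at h2
  -- The constant of integration is dictated by `f 0 = e^{iθ} f 1`; the denominator is nonzero since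
  -- `|e^{iθ} e^{-1}| < 1`.
  set C : ℂ := Complex.exp (Complex.I * θ) * Complex.exp (-1) * (Complex.I * J 1) /
    (1 - Complex.exp (Complex.I * θ) * Complex.exp (-1)) with hC
  set f : ℝ → ℂ := fun t => Complex.exp (-1 * t) * (C + Complex.I * J t) with hf
  have hac : AbsolutelyContinuousOnInterval f 0 1 :=
    (ac_exp_mul (-1) 0 1).smul
      ((absolutelyContinuousOnInterval_const C 0 1).add (hJac.const_smul Complex.I))
  have hderiv : deriv f =ᵐ[volI] fun t => -f t + Complex.I * v t := by
    filter_upwards [ae_volI_of_ae hg.ae_hasDerivAt_integral,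
      ae_restrict_mem measurableSet_Icc] with t ht ht'
    have h1 : HasDerivAt J (Complex.exp (1 * t) * v t) t := ht 0 left_mem_uIcc
    have h2 : HasDerivAt f _ t := (hasDerivAt_exp_mul (-1) t).mul ((h1.const_mul Complex.I).const_add C)
    rw [h2.deriv, hf]
    have h3 : Complex.exp (-1 * t) * Complex.exp (1 * t) = 1 := by
      rw [← Complex.exp_add]; simp
    linear_combination Complex.I * v t * h3
  have hfL : MemLp f 2 volI := by
    have hc := hac.continuousOn
    rw [uIcc_of_le zero_le_one] at hc
    obtain ⟨B, hB⟩ := isCompact_Icc.exists_bound_of_continuousOn hc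
    refine MemLp.of_bound (hc.aestronglyMeasurable measurableSet_Icc) B ?_
    filter_upwards [ae_restrict_mem measurableSet_Icc] with t ht using hB t ht
  have hH1 : IsTwistedH1 θ f := by
    refine ⟨hac, (hfL.neg.add ((Lp.memLp v).const_mul Complex.I)).ae_eq hderiv.symm, ?_⟩
    have hJ0 : J 0 = 0 := intervalIntegral.integral_same
    simp only [hf, hJ0, Complex.ofReal_zero, Complex.ofReal_one, mul_zero, Complex.exp_zero,
      add_zero, one_mul, mul_one]
    have hC' : C * (1 - Complex.exp (Complex.I * θ) * Complex.exp (-1)) =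
      Complex.exp (Complex.I * θ) * Complex.exp (-1) * (Complex.I * J 1) := div_mul_cancel₀ _ hq
    linear_combination hC'
  have hw : (hfL.toLp f : ℝ → ℂ) =ᵐ[volI] f := hfL.coeFn_toLp
  refine ⟨⟨hfL.toLp f, f, hH1, hw⟩, Lp.ext ?_⟩
  filter_upwards [Lp.coeFn_sub ((-Complex.I) • hfL.toLp f)
      (twistedOperator θ ⟨hfL.toLp f, f, hH1, hw⟩), Lp.coeFn_smul (-Complex.I) (hfL.toLp f), hw,
    coeFn_twistedOperator ⟨hfL.toLp f, f, hH1, hw⟩ hH1 hw, hderiv] with t h1 h2 h3 h4 h5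
  rw [h1, Pi.sub_apply, h2, Pi.smul_apply, h3, h4, h5, smul_eq_mul]
  linear_combination (-v t) * Complex.I_sq

/-- The eigenvalues `θ - 2πk` of `twistedOperator θ`. -/
def twistedEigenvalue (θ : ℝ) (k : ℤ) : ℝ := θ - 2 * Real.pi * k

theorem isDiagonal_twistedOperator (θ : ℝ) :
    IsDiagonal (twistedOperator θ) (twistedBasis θ) (twistedEigenvalue θ) := by
  have hrepr : ∀ (u : (twistedOperator θ).domain) k,
      (twistedBasis θ).repr (twistedOperator θ u) k =
        twistedEigenvalue θ k * (twistedBasis θ).repr (u : L2I) k := fun u k => by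
    rw [HilbertBasis.repr_apply_apply, HilbertBasis.repr_apply_apply, twistedBasis_apply,
      inner_expLp_twistedOperator, twistedEigenvalue]
    push_cast
    rfl
  intro u v
  constructor
  · intro h k
    obtain ⟨y, hy1, hy2⟩ := (LinearPMap.mem_graph_iff _).mp h
    simp only at hy1 hy2
    rw [← hy1, ← hy2, hrepr]
  · intro h
    -- The pair `(u, v)` formally satisfies the same equation as `w`, and since `-i - μ k ≠ 0` their
    -- coordinates agree; thus `u = w` lies in the domain.
    obtain ⟨w, hw⟩ := exists_twistedOperator_solution θ ((-Complex.I) • u - v)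
    have hwu : (w : L2I) = u := by
      refine repr_ext (b := twistedBasis θ) fun k => ?_
      have h1 := congrArg (fun x => (twistedBasis θ).repr x k) hw
      simp only [map_sub, map_smul, lp.coeFn_sub, lp.coeFn_smul, Pi.sub_apply, Pi.smul_apply,
        smul_eq_mul, hrepr, h k, ← sub_mul] at h1
      refine mul_left_cancel₀ (fun h0 => I_add_ofReal_ne_zero (twistedEigenvalue θ k) ?_) h1
      linear_combination -h0
    rw [LinearPMap.mem_graph_iff]
    refine ⟨w, hwu, ?_⟩
    rw [hwu] at hw
    exact sub_right_injective hw

end TwistedOperator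

/-! ### Unitary operators `U` with `U + 1` Fredholm -/

section Unitary

variable {H : Type*} [NormedAddCommGroup H] [InnerProductSpace ℂ H]

/-- `U + 1` is bounded below by `c` on the orthogonal complement of `V`. -/
def IsBoundedBelowOff (V : Submodule ℂ H) (c : ℝ) (U : H →L[ℂ] H) : Prop :=
  ∀ x ∈ Vᗮ, c * ‖x‖ ≤ ‖U x + x‖

theorem IsBoundedBelowOff.mono {V W : Submodule ℂ H} {c d : ℝ} {U : H →L[ℂ] H}
    (h : IsBoundedBelowOff V c U) (hVW : V ≤ W) (hdc : d ≤ c) : IsBoundedBelowOff W d U :=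
  fun x hx => (mul_le_mul_of_nonneg_right hdc (norm_nonneg x)).trans
    (h x (Submodule.orthogonal_le hVW hx))

/-- On a compact set, boundedness below off a finite-dimensional space holds uniformly. -/
theorem exists_isBoundedBelowOff {K : Set (H →L[ℂ] H)} (hK : IsCompact K)
    (h : ∀ U ∈ K, ∃ V : Submodule ℂ H, FiniteDimensional ℂ V ∧ ∃ c > 0, IsBoundedBelowOff V c U) :
    ∃ V : Submodule ℂ H, FiniteDimensional ℂ V ∧ ∃ c > 0, ∀ U ∈ K, IsBoundedBelowOff V c U := by
  refine hK.induction_on (p := fun S => ∃ V : Submodule ℂ H, FiniteDimensional ℂ V ∧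
    ∃ c > 0, ∀ U ∈ S, IsBoundedBelowOff V c U) ?_ ?_ ?_ ?_
  · exact ⟨⊥, inferInstance, 1, one_pos, by simp⟩
  · rintro S S' hS ⟨V, hV, c, hc, hU⟩
    exact ⟨V, hV, c, hc, fun U hUS => hU U (hS hUS)⟩
  · rintro S S' ⟨V, hV, c, hc, hU⟩ ⟨V', hV', c', hc', hU'⟩
    refine ⟨V ⊔ V', inferInstance, min c c', lt_min hc hc', ?_⟩
    rintro U (hUS | hUS)
    · exact (hU U hUS).mono le_sup_left (min_le_left _ _)
    · exact (hU' U hUS).mono le_sup_right (min_le_right _ _)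
  · intro U hU
    obtain ⟨V, hV, c, hc, hb⟩ := h U hU
    -- A perturbation of norm below `c / 2` costs at most half of the lower bound, with the same
    -- `V`.
    refine ⟨Metric.ball U (c / 2), mem_nhdsWithin_of_mem_nhds (Metric.ball_mem_nhds _ (by positivity)),
      V, hV, c / 2, by positivity, fun U' hU' x hx => ?_⟩
    have h1 := hb x hx
    have h2 : ‖(U' - U) x‖ ≤ c / 2 * ‖x‖ := by
      refine ContinuousLinearMap.le_of_opNorm_le _ ?_ x
      rw [← dist_eq_norm]
      exact (Metric.mem_ball.mp hU').le
    have h3 : U x + x = U' x + x - (U' - U) x := by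
      rw [sub_apply]; abel
    have h4 := norm_sub_le (U' x + x) ((U' - U) x)
    rw [← h3] at h4
    linarith

/-- Expand `‖U x + x‖ ^ 2 = 2 ‖x‖ ^ 2 + 2 Re ⟪U x, x⟫` and compare with `c ^ 2 ‖x‖ ^ 2`. -/
theorem re_inner_ge_of_isBoundedBelowOff {V : Submodule ℂ H} {c : ℝ} {U : H →L[ℂ] H}
    (hc : 0 ≤ c) (hU : ∀ x, ‖U x‖ = ‖x‖) (h : IsBoundedBelowOff V c U) {x : H} (hx : x ∈ Vᗮ) :
    (c ^ 2 / 2 - 1) * ‖x‖ ^ 2 ≤ RCLike.re (inner ℂ (U x) x) := by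
  have h1 := pow_le_pow_left₀ (by positivity) (h x hx) 2
  rw [norm_add_sq (𝕜 := ℂ), hU, mul_pow] at h1
  linarith

/-- The determinant of the compression of `(U + a)⁻¹` to a finite-dimensional subspace. -/
def compressionDet (V : Submodule ℂ H) [FiniteDimensional ℂ V] (a : ℝ) (U : H →L[ℂ] H) : ℂ :=
  ContinuousLinearMap.det (V.orthogonalProjectionOnto ∘L
    Ring.inverse (U + (a : ℂ) • (1 : H →L[ℂ] H)) ∘L V.subtypeL)

/-- For `U + a` with inverse `α + β ⟪e, ·⟫ e`, the compressed determinant is explicit. -/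
theorem compressionDet_eq (V : Submodule ℂ H) [FiniteDimensional ℂ V] {a : ℝ} {U R : H →L[ℂ] H}
    (hR : (U + (a : ℂ) • (1 : H →L[ℂ] H)) * R = 1) (hR' : R * (U + (a : ℂ) • (1 : H →L[ℂ] H)) = 1)
    {α β : ℂ} {e : H} (h : ∀ x, R x = α • (x + (β * inner ℂ e x) • e)) :
    compressionDet V a U = α ^ Module.finrank ℂ V * (1 + β * ‖V.orthogonalProjectionOnto e‖ ^ 2) := by
  have h1 : Ring.inverse (U + (a : ℂ) • (1 : H →L[ℂ] H)) = R :=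
    Ring.inverse_unit ⟨_, R, hR, hR'⟩
  set e' := V.orthogonalProjectionOnto e with he'
  -- Compressing a rank-one perturbation of the identity gives a rank-one perturbation of the
  -- identity of `V`, with `e` replaced by its projection.
  have h2 : ((V.orthogonalProjectionOnto ∘L R ∘L V.subtypeL : V →L[ℂ] V) : V →ₗ[ℂ] V) =
      α • LinearMap.transvection (β • (innerSL ℂ e' : V →ₗ[ℂ] ℂ)) e' := by
    ext1 v
    have h3 : inner ℂ e (v : H) = inner ℂ e' v := by
      rw [he', Submodule.inner_orthogonalProjectionOnto_eq_of_mem_right]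
    have h4 : V.orthogonalProjectionOnto (v : H) = v :=
      V.orthogonalProjectionOnto_mem_subspace_eq_self v
    change V.orthogonalProjectionOnto (R v) = α • (v + (β * inner ℂ e' v) • e')
    rw [h, map_smul, map_add, map_smul, h3, h4]
  rw [compressionDet, h1, ContinuousLinearMap.det, h2, LinearMap.det_smul,
    LinearMap.transvection.det]
  congr 2
  simp

variable [CompleteSpace H]

theorem mem_unitary_of_norm_map_of_surjective {U : H →L[ℂ] H} (h : ∀ x, ‖U x‖ = ‖x‖)
    (hs : Function.Surjective U) : U ∈ unitary (H →L[ℂ] H) := by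
  have hinj : Function.Injective U := by
    rw [injective_iff_map_eq_zero]
    intro x hx
    rw [← norm_eq_zero, ← h, hx, norm_zero]
  have hunit : IsUnit U := ContinuousLinearMap.isUnit_iff_bijective.mpr ⟨hinj, hs⟩
  refine hunit.mem_unitary_of_star_mul_self ?_
  exact (ContinuousLinearMap.norm_map_iff_adjoint_comp_self U).mp h

theorem isUnit_add_of_mem_unitary {U : H →L[ℂ] H} (hU : U ∈ unitary (H →L[ℂ] H)) {a : ℝ}
    (h0 : 0 ≤ a) (h1 : a < 1) : IsUnit (U + (a : ℂ) • (1 : H →L[ℂ] H)) := by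
  have h : (-a : ℂ) ∉ spectrum ℂ U := fun hmem => by
    have := spectrum.subset_circle_of_unitary hU hmem
    rw [mem_sphere_zero_iff_norm, norm_neg, Complex.norm_real, Real.norm_eq_abs,
      abs_of_nonneg h0] at this
    linarith
  rw [spectrum.notMem_iff, Algebra.algebraMap_eq_smul_one] at h
  have e : U + (a : ℂ) • (1 : H →L[ℂ] H) = -((-a : ℂ) • (1 : H →L[ℂ] H) - U) := by
    rw [neg_smul]; abel
  rw [e]
  exact h.neg

theorem continuous_compressionDet (V : Submodule ℂ H) [FiniteDimensional ℂ V] {a : ℝ}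
    (h0 : 0 ≤ a) (h1 : a < 1) {X : Type*} [TopologicalSpace X] {U : X → H →L[ℂ] H}
    (hc : Continuous U) (hU : ∀ p, U p ∈ unitary (H →L[ℂ] H)) :
    Continuous fun p => compressionDet V a (U p) := by
  refine ContinuousLinearMap.continuous_det.comp
    (continuous_const.clm_comp (Continuous.clm_comp ?_ continuous_const))
  rw [continuous_iff_continuousAt]
  intro p
  obtain ⟨u, hu⟩ := isUnit_add_of_mem_unitary (hU p) h0 h1
  have h2 : ContinuousAt Ring.inverse (U p + (a : ℂ) • (1 : H →L[ℂ] H)) := by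
    rw [← hu]; exact NormedRing.inverse_continuousAt u
  exact ContinuousAt.comp (g := Ring.inverse) (f := fun p => U p + (a : ℂ) • (1 : H →L[ℂ] H)) h2
    (hc.add continuous_const).continuousAt

/-- If the compression kills `v`, then `w = (U + a)⁻¹ v` is orthogonal to `V`, so `⟪(U + a) w, w⟫ =
0`. Its real part is at least `(c ^ 2 / 2 - 1 + a) ‖w‖ ^ 2` with a positive coefficient, hence `w =
0` and `v = 0`. -/
theorem compressionDet_ne_zero (V : Submodule ℂ H) [FiniteDimensional ℂ V] {a c : ℝ}
    (h0 : 0 ≤ a) (h1 : a < 1) (hc : 0 ≤ c) (hac : 1 - c ^ 2 / 2 < a) {U : H →L[ℂ] H}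
    (hU : U ∈ unitary (H →L[ℂ] H)) (h : IsBoundedBelowOff V c U) : compressionDet V a U ≠ 0 := by
  obtain ⟨u, hu⟩ := isUnit_add_of_mem_unitary hU h0 h1
  have hinj : Function.Injective (V.orthogonalProjectionOnto ∘L
      Ring.inverse (U + (a : ℂ) • (1 : H →L[ℂ] H)) ∘L V.subtypeL) := by
    rw [injective_iff_map_eq_zero]
    intro v hv
    set w := Ring.inverse (U + (a : ℂ) • (1 : H →L[ℂ] H)) v with hw
    have hwV : w ∈ Vᗮ := V.orthogonalProjectionOnto_eq_zero_iff.mp hv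
    have huw : U w + (a : ℂ) • w = v := by
      have h2 : (U + (a : ℂ) • (1 : H →L[ℂ] H)) *
          Ring.inverse (U + (a : ℂ) • (1 : H →L[ℂ] H)) = 1 :=
        Ring.mul_inverse_cancel _ ⟨u, hu⟩
      exact congrArg (fun R : H →L[ℂ] H => R v) h2
    have h3 : inner ℂ (U w + (a : ℂ) • w) w = 0 := by
      rw [huw]; exact (Submodule.mem_orthogonal _ _).mp hwV _ v.2
    have h4 := re_inner_ge_of_isBoundedBelowOff hc
      (ContinuousLinearMap.norm_map_of_mem_unitary hU) h hwV
    have h5 := congrArg RCLike.re h3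
    rw [inner_add_left, inner_smul_left, map_add, inner_self_eq_norm_sq_to_K] at h5
    have h6 : RCLike.re ((starRingEnd ℂ) (a : ℂ) * ((‖w‖ : ℂ) ^ 2)) = a * ‖w‖ ^ 2 := by
      rw [Complex.conj_ofReal]
      norm_cast
    have h7 : RCLike.re (0 : ℂ) = 0 := map_zero _
    have h8 : (c ^ 2 / 2 - 1 + a) * ‖w‖ ^ 2 ≤ 0 := by
      have h9 : RCLike.re (inner ℂ (U w) w) + a * ‖w‖ ^ 2 = 0 := by
        rw [← h6, ← h7]; exact h5
      linarith
    have h10 : ‖w‖ ^ 2 ≤ 0 := by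
      by_contra hlt
      push Not at hlt
      nlinarith
    have h11 : w = 0 := by
      rw [← norm_eq_zero]
      exact pow_eq_zero_iff two_ne_zero |>.mp (le_antisymm h10 (sq_nonneg _))
    rw [h11, map_zero, smul_zero, add_zero] at huw
    exact Subtype.ext huw.symm
  have h2 : IsUnit ((V.orthogonalProjectionOnto ∘L
      Ring.inverse (U + (a : ℂ) • (1 : H →L[ℂ] H)) ∘L V.subtypeL : V →L[ℂ] V) : V →ₗ[ℂ] V) :=
    LinearMap.isUnit_iff_ker_eq_bot _ |>.mpr (LinearMap.ker_eq_bot.mpr hinj)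
  exact (LinearMap.isUnit_iff_isUnit_det _ |>.mp h2).ne_zero

end Unitary

/-! ### The Cayley transform of a selfadjoint Fredholm operator -/

section Cayley

variable {H : Type*} [NormedAddCommGroup H] [InnerProductSpace ℂ H] [CompleteSpace H]
variable {T : H →ₗ.[ℂ] H}

theorem inner_apply_left_of_isSelfAdjoint (hT : IsSelfAdjoint T) (x y : T.domain) :
    inner ℂ (T x) (y : H) = inner ℂ (x : H) (T y) := by
  have := T.adjoint_isFormalAdjoint hT.dense_domain
  rw [LinearPMap.isSelfAdjoint_def.mp hT] at this
  exact this x y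

theorem re_inner_I_smul_of_isSelfAdjoint (hT : IsSelfAdjoint T) (u : T.domain) :
    RCLike.re (inner ℂ (T u) (Complex.I • (u : H))) = 0 := by
  have h2 : (starRingEnd ℂ) (inner ℂ (T u) (u : H)) = inner ℂ (T u) (u : H) := by
    rw [inner_conj_symm, inner_apply_left_of_isSelfAdjoint hT]
  rw [inner_smul_right]
  simp [Complex.conj_eq_iff_im.mp h2]

theorem exists_apply_add_I_smul (hT : IsSelfAdjoint T) (v : H) :
    ∃ u : T.domain, T u + Complex.I • (u : H) = v := by
  obtain ⟨u, hu⟩ := (neg_I_mem_resolventSet hT).1.2 (-v)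
  refine ⟨u, ?_⟩
  have hu' : (-Complex.I) • (u : H) - T u = -v := hu
  rw [← neg_neg v, ← hu']
  module

/-- The vectors `T u ± i u` have equal norms because `⟪T u, u⟫` is real, which kills the cross term.
-/
theorem norm_cayley_apply (hT : IsSelfAdjoint T) (v : H) : ‖cayley T v‖ = ‖v‖ := by
  obtain ⟨u, rfl⟩ := exists_apply_add_I_smul hT v
  rw [cayley_apply hT]
  have h1 : ‖T u - Complex.I • (u : H)‖ ^ 2 = ‖T u + Complex.I • (u : H)‖ ^ 2 := by
    rw [norm_add_sq (𝕜 := ℂ), norm_sub_sq (𝕜 := ℂ), re_inner_I_smul_of_isSelfAdjoint hT]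
    ring
  exact (pow_left_inj₀ (norm_nonneg _) (norm_nonneg _) two_ne_zero).mp h1

/-- The range of an isometry is closed, and a vector `y` orthogonal to it satisfies `T y = -i y`,
impossible for selfadjoint `T` unless `y = 0`. -/
theorem cayley_surjective (hT : IsSelfAdjoint T) : Function.Surjective (cayley T) := by
  have hiso : Isometry (cayley T) := AddMonoidHomClass.isometry_of_norm _ (norm_cayley_apply hT)
  have hcl : IsClosed ((LinearMap.range (cayley T : H →ₗ[ℂ] H) : Submodule ℂ H) : Set H) := by
    rw [LinearMap.coe_range]
    exact hiso.isClosedEmbedding.isClosed_range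
  have : CompleteSpace (LinearMap.range (cayley T : H →ₗ[ℂ] H)) := hcl.completeSpace_coe
  change Function.Surjective (cayley T : H →ₗ[ℂ] H)
  rw [← LinearMap.range_eq_top, ← Submodule.orthogonal_eq_bot_iff, Submodule.eq_bot_iff]
  intro y hy
  have hy' : ∀ x : T.domain, inner ℂ ((-Complex.I) • y) (x : H) = inner ℂ y (T x) := by
    intro x
    have h := (Submodule.mem_orthogonal' _ _).mp hy _ ⟨T x + Complex.I • (x : H), rfl⟩
    rw [ContinuousLinearMap.coe_coe, cayley_apply hT, inner_sub_right, sub_eq_zero,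
      inner_smul_right] at h
    rw [h, inner_smul_left]
    simp
  have hyd : y ∈ T.adjoint.domain := T.mem_adjoint_domain_of_exists y ⟨_, hy'⟩
  have hTy : T.adjoint ⟨y, hyd⟩ = (-Complex.I) • y :=
    T.adjoint_apply_eq hT.dense_domain ⟨y, hyd⟩ hy'
  have hmem : (y, (-Complex.I) • y) ∈ T.adjoint.graph :=
    (LinearPMap.mem_graph_iff _).mpr ⟨⟨y, hyd⟩, rfl, hTy⟩
  rw [LinearPMap.isSelfAdjoint_def.mp hT] at hmem
  obtain ⟨z, hz1, hz2⟩ := (LinearPMap.mem_graph_iff T).mp hmem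
  simp only at hz1 hz2
  have h0 := re_inner_I_smul_of_isSelfAdjoint hT z
  rw [hz2, hz1, neg_smul, inner_neg_left, map_neg, inner_self_eq_norm_sq, norm_smul,
    Complex.norm_I, one_mul, neg_eq_zero] at h0
  exact norm_eq_zero.mp ((pow_eq_zero_iff two_ne_zero).mp h0)

theorem cayley_mem_unitary (hT : IsSelfAdjoint T) : cayley T ∈ unitary (H →L[ℂ] H) :=
  mem_unitary_of_norm_map_of_surjective (norm_cayley_apply hT) (cayley_surjective hT)

/-- Restricted to the complement of its kernel, `B` is injective with range of finite codimension.
Such a range is closed, so the open mapping theorem gives a lower bound. -/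
theorem isBoundedBelowOff_ker (B U : H →L[ℂ] H) (hB : B = U + 1)
    [FiniteDimensional ℂ (LinearMap.ker (B : H →ₗ[ℂ] H))]
    [FiniteDimensional ℂ (H ⧸ LinearMap.range (B : H →ₗ[ℂ] H))] :
    ∃ c > 0, IsBoundedBelowOff (LinearMap.ker (B : H →ₗ[ℂ] H)) c U := by
  set V := LinearMap.ker (B : H →ₗ[ℂ] H) with hV
  let f : Vᗮ →L[ℂ] H := B ∘L Vᗮ.subtypeL
  have hkerf : f.ker = ⊥ := by
    rw [LinearMap.ker_eq_bot']
    intro x hx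
    have h1 : (x : H) ∈ V := hx
    have h2 : (x : H) ∈ V ⊓ Vᗮ := ⟨h1, x.2⟩
    rw [Submodule.inf_orthogonal_eq_bot] at h2
    exact Subtype.ext h2
  have hranf : f.range = LinearMap.range (B : H →ₗ[ℂ] H) := by
    refine le_antisymm ?_ ?_
    · rintro _ ⟨x, rfl⟩
      exact ⟨x, rfl⟩
    · rintro _ ⟨x, rfl⟩
      refine ⟨⟨x - V.starProjection x, V.sub_starProjection_mem_orthogonal x⟩, ?_⟩
      have h1 : B (V.starProjection x) = 0 := by
        have : V.starProjection x ∈ V := V.starProjection_apply_mem x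
        exact this
      change B (x - V.starProjection x) = B x
      rw [map_sub, h1, sub_zero]
  obtain ⟨G, hG⟩ := Submodule.exists_isCompl f.range
  have hGfin : FiniteDimensional ℂ G := by
    rw [hranf] at hG
    exact LinearEquiv.finiteDimensional (Submodule.quotientEquivOfIsCompl _ _ hG)
  have hcl := f.closed_complemented_range_of_isCompl_of_ker_eq_bot G hG
    G.closed_of_finiteDimensional hkerf
  obtain ⟨K, hK⟩ := f.antilipschitz_of_injective_of_isClosed_range
    (LinearMap.ker_eq_bot.mp hkerf) hcl
  -- Adding `1` keeps the constant positive even if `K = 0`.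
  refine ⟨((K : ℝ) + 1)⁻¹, by positivity, fun x hx => ?_⟩
  have h1 := hK.le_mul_dist ⟨x, hx⟩ 0
  have h2 : f ⟨x, hx⟩ = U x + x := by
    change B x = _
    rw [hB]; rfl
  rw [dist_zero_right, map_zero, dist_zero_right, h2] at h1
  rw [inv_mul_le_iff₀ (by positivity)]
  have h3 : ‖x‖ ≤ K * ‖U x + x‖ := h1
  linarith [norm_nonneg (U x + x)]

/-- Since `cayley T + 1` sends `T u + i u` to `2 T u`, it inherits a finite-dimensional kernel and
cokernel from `T`. -/
theorem exists_isBoundedBelowOff_cayley (hT : IsSelfAdjoint T) (hF : IsFredholm T) :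
    ∃ V : Submodule ℂ H, FiniteDimensional ℂ V ∧ ∃ c > 0, IsBoundedBelowOff V c (cayley T) := by
  set B : H →L[ℂ] H := cayley T + 1 with hB
  have hBapp : ∀ u : T.domain, B (T u + Complex.I • (u : H)) = (2 : ℂ) • T u := fun u => by
    rw [hB, add_apply, cayley_apply hT, one_apply_eq_self]
    module
  obtain ⟨-, hker, hran⟩ := hF
  have hker' : FiniteDimensional ℂ (LinearMap.ker (B : H →ₗ[ℂ] H)) := by
    have hle : LinearMap.ker (B : H →ₗ[ℂ] H) ≤
        (LinearMap.ker T.toFun).map T.domain.subtype := by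
      intro v hv
      obtain ⟨u, rfl⟩ := exists_apply_add_I_smul hT v
      have h1 : (2 : ℂ) • T u = 0 := by rw [← hBapp]; exact hv
      have h2 : T u = 0 := (smul_eq_zero.mp h1).resolve_left two_ne_zero
      rw [h2, zero_add]
      exact Submodule.smul_mem _ _ ⟨u, h2, rfl⟩
    exact Submodule.finiteDimensional_of_le hle
  have hran' : FiniteDimensional ℂ (H ⧸ LinearMap.range (B : H →ₗ[ℂ] H)) := by
    have hle : LinearMap.range T.toFun ≤ LinearMap.range (B : H →ₗ[ℂ] H) := by
      rintro _ ⟨u, rfl⟩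
      refine ⟨(2 : ℂ)⁻¹ • (T u + Complex.I • (u : H)), ?_⟩
      rw [map_smul, ContinuousLinearMap.coe_coe, hBapp, inv_smul_smul₀ two_ne_zero]
      rfl
    exact FiniteDimensional.of_surjective (Submodule.factor hle) (Submodule.factor_surjective hle)
  exact ⟨_, hker', isBoundedBelowOff_ker B _ hB⟩

end Cayley

/-! ### Continuous logarithms of loops in the punctured plane -/

section Logarithm

/-- Two continuous functions on a preconnected set with the same exponential, and which agree at
a point, agree. -/
theorem eqOn_of_exp_eqOn {A : Type*} [TopologicalSpace A] {S : Set A} (hS : IsPreconnected S)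
    {f g : A → ℂ} (hf : ContinuousOn f S) (hg : ContinuousOn g S)
    (h : ∀ x ∈ S, Complex.exp (f x) = Complex.exp (g x)) {x₀ : A} (hx₀ : x₀ ∈ S)
    (h₀ : f x₀ = g x₀) : EqOn f g S :=
  Complex.isCoveringMap_exp.eqOn_of_comp_eqOn hS hf hg (fun x hx => Subtype.ext (h x hx)) hx₀ h₀

/-- Continuous functions with the same exponential have the same increments. -/
theorem sub_eq_sub_of_exp_eqOn {A : Type*} [TopologicalSpace A] {S : Set A} (hS : IsPreconnected S)
    {f g : A → ℂ} (hf : ContinuousOn f S) (hg : ContinuousOn g S)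
    (h : ∀ x ∈ S, Complex.exp (f x) = Complex.exp (g x)) {x y : A} (hx : x ∈ S) (hy : y ∈ S) :
    f y - f x = g y - g x := by
  have h1 := eqOn_of_exp_eqOn (g := fun z => g z + (f x - g x)) hS hf (hg.add continuousOn_const)
    (fun z hz => by
      rw [Complex.exp_add, Complex.exp_sub, h x hx, div_self (Complex.exp_ne_zero _), mul_one,
        h z hz]) hx (by ring) hy
  rw [h1]
  ring

/-- The loop `γ` has a continuous logarithm which is again a loop. -/
def HasClosedLog (γ : I → ℂ) : Prop :=
  ∃ φ : ℝ → ℂ, Continuous φ ∧ (∀ t, Complex.exp (φ t) = γ (projIcc 0 1 zero_le_one t)) ∧ φ 0 = φ 1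

theorem hasClosedLog_const {c : ℂ} (hc : c ≠ 0) : HasClosedLog fun _ => c :=
  ⟨fun _ => Complex.log c, continuous_const, fun _ => Complex.exp_log hc, rfl⟩

/-- Lift `G` through `exp` over the whole square. The lifts along the sides `t = 0` and `t = 1` have
the same increment, so the increment of the logarithm around the loop does not depend on `s`. -/
theorem HasClosedLog.of_homotopy {G : I × I → ℂ} (hG : Continuous G) (h0 : ∀ p, G p ≠ 0)
    (hper : ∀ s, G (s, 0) = G (s, 1)) (h1 : HasClosedLog fun t => G (1, t)) :
    HasClosedLog fun t => G (0, t) := by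
  let π : ℝ → I := projIcc 0 1 zero_le_one
  have hπ : Continuous π := continuous_projIcc
  have hπ0 : π 0 = 0 := projIcc_left _
  have hπ1 : π 1 = 1 := projIcc_right _
  -- Clamping the parameters extends `G` to the simply connected plane, where the lift exists.
  let F : C(ℝ × ℝ, ℂ) := ⟨fun p => G (π p.1, π p.2), by fun_prop⟩
  obtain ⟨Φ, ⟨-, hΦ⟩, -⟩ := Complex.isCoveringMapOn_exp.existsUnique_continuousMap_lifts F
    (a₀ := 0) (Complex.exp_log (h0 _)) (fun p => h0 _)
  have hΦ' : ∀ s t, Complex.exp (Φ (s, t)) = G (π s, π t) := fun s t => congrFun hΦ (s, t)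
  have hcont : ∀ t, Continuous fun s => Φ (s, t) := fun t => by fun_prop
  have hinc := sub_eq_sub_of_exp_eqOn isPreconnected_univ (hcont 0).continuousOn
    (hcont 1).continuousOn (fun s _ => by rw [hΦ', hΦ', hπ0, hπ1, hper]) (mem_univ 0) (mem_univ 1)
  obtain ⟨φ, hφ, hφe, hφ1⟩ := h1
  have hinc' := sub_eq_sub_of_exp_eqOn isPreconnected_univ
    (f := fun t => Φ (1, t)) (by fun_prop) hφ.continuousOn
    (fun t _ => by rw [hΦ', hφe, hπ1]) (mem_univ 0) (mem_univ 1)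
  refine ⟨fun t => Φ (0, t), by fun_prop, fun t => by rw [hΦ', hπ0], ?_⟩
  rw [hφ1, sub_self] at hinc'
  linear_combination -hinc - hinc'

/-- A loop which passes from `1` to the negative real axis through the lower half plane, and back
through the upper half plane, has no closed logarithm. -/
theorem not_hasClosedLog {γ : I → ℂ} {m : I} (h0 : γ 0 = 1) (h1 : γ 1 = 1)
    (hm : (γ m).im = 0 ∧ (γ m).re < 0) (hlt : ∀ t < m, (γ t).im < 0 ∨ γ t = 1)
    (hgt : ∀ t > m, 0 < (γ t).im ∨ γ t = 1) : ¬ HasClosedLog γ := by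
  rintro ⟨φ, hφ, hφe, hφ01⟩
  have hπ : ∀ t : I, projIcc (0 : ℝ) 1 zero_le_one t = t := projIcc_val _
  have hφe' : ∀ t : I, Complex.exp (φ t) = γ t := fun t => by rw [hφe, hπ]
  have hmem : ∀ {x y t : ℝ}, x ∈ I → y ∈ I → t ∈ Icc x y → t ∈ I := fun hx hy ht =>
    ⟨hx.1.trans ht.1, ht.2.trans hy.2⟩
  have hI : Complex.exp (Complex.I * (Real.pi / 2)) = Complex.I := by
    rw [mul_comm, Complex.exp_mul_I]
    norm_cast
    simp
  have hI' : Complex.exp (-(Complex.I * (Real.pi / 2))) = -Complex.I := by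
    rw [Complex.exp_neg, hI, Complex.inv_I]
  -- a branch of the logarithm on the first half
  have hs1 : ∀ t ∈ Icc (0 : ℝ) m, Complex.I * Complex.exp (φ t) ∈ Complex.slitPlane := by
    intro t ht
    have ht' : t ∈ I := hmem (0 : I).2 m.2 ht
    rw [show t = ((⟨t, ht'⟩ : I) : ℝ) from rfl, hφe', Complex.mem_slitPlane_iff]
    rcases eq_or_lt_of_le ht.2 with h | h
    · have : (⟨t, ht'⟩ : I) = m := Subtype.ext h
      rw [this]
      right
      simpa using hm.2.ne
    · rcases hlt ⟨t, ht'⟩ h with h2 | h2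
      · left; simpa using h2
      · right; simp [h2]
  have hs2 : ∀ t ∈ Icc (m : ℝ) 1, -Complex.I * Complex.exp (φ t) ∈ Complex.slitPlane := by
    intro t ht
    have ht' : t ∈ I := hmem m.2 (1 : I).2 ht
    rw [show t = ((⟨t, ht'⟩ : I) : ℝ) from rfl, hφe', Complex.mem_slitPlane_iff]
    rcases eq_or_lt_of_le ht.1 with h | h
    · have : (⟨t, ht'⟩ : I) = m := Subtype.ext h.symm
      rw [this]
      right
      simpa using hm.2.ne
    · rcases hgt ⟨t, ht'⟩ h with h2 | h2
      · left; simpa using h2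
      · right; simp [h2]
  have hc : Continuous fun t => Complex.exp (φ t) := by fun_prop
  -- On the first half the loop avoids the positive imaginary axis, so `z ↦ log (i z) - iπ/2` is a
  -- branch there; on the second half the cut is the negative imaginary axis.
  have e1 := sub_eq_sub_of_exp_eqOn (f := φ)
    (g := fun t => Complex.log (Complex.I * Complex.exp (φ t)) + -(Complex.I * (Real.pi / 2)))
    isPreconnected_Icc hφ.continuousOn
    (((continuousOn_const.mul hc.continuousOn).clog hs1).add continuousOn_const)
    (fun t ht => by
      rw [Complex.exp_add, Complex.exp_log (Complex.slitPlane_ne_zero (hs1 t ht)), hI']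
      linear_combination (Complex.exp (φ t)) * Complex.I_sq)
    (left_mem_Icc.mpr m.2.1) (right_mem_Icc.mpr m.2.1)
  have e2 := sub_eq_sub_of_exp_eqOn (f := φ)
    (g := fun t => Complex.log (-Complex.I * Complex.exp (φ t)) + Complex.I * (Real.pi / 2))
    isPreconnected_Icc hφ.continuousOn
    (((continuousOn_const.mul hc.continuousOn).clog hs2).add continuousOn_const)
    (fun t ht => by
      rw [Complex.exp_add, Complex.exp_log (Complex.slitPlane_ne_zero (hs2 t ht)), hI]
      linear_combination (Complex.exp (φ t)) * Complex.I_sq)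
    (left_mem_Icc.mpr m.2.2) (right_mem_Icc.mpr m.2.2)
  have v0 : Complex.exp (φ 0) = 1 := by
    have := hφe' 0
    rwa [h0] at this
  have v1 : Complex.exp (φ 1) = 1 := by
    have := hφe' 1
    rwa [h1] at this
  obtain ⟨r, hr, hrm⟩ : ∃ r : ℝ, 0 < r ∧ γ m = -r :=
    ⟨-(γ m).re, by linarith [hm.2], Complex.ext (by simp) (by simp [hm.1])⟩
  simp only [v0, v1, hφe' m, hrm, mul_one] at e1 e2
  have l1 : Complex.log (Complex.I * -(r : ℂ)) = Real.log r + -(Real.pi / 2) * Complex.I := by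
    rw [show Complex.I * -(r : ℂ) = r * -Complex.I by ring,
      Complex.log_ofReal_mul hr (by simp), Complex.log_neg_I]
  have l2 : Complex.log (-Complex.I * -(r : ℂ)) = Real.log r + (Real.pi / 2) * Complex.I := by
    rw [show -Complex.I * -(r : ℂ) = r * Complex.I by ring,
      Complex.log_ofReal_mul hr (by simp), Complex.log_I]
  rw [l1, Complex.log_I] at e1
  rw [l2, Complex.log_neg_I] at e2
  -- The two halves contribute `log r - iπ` and `-log r - iπ`, so `φ` changes by `-2πi` in total.
  have e3 : (2 * Real.pi * Complex.I : ℂ) = 0 := by linear_combination e1 + e2 + hφ01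
  simp [Real.pi_ne_zero] at e3

end Logarithm

/-! ### A homotopy of symbols -/

section Symbol

/-- The real part of the homotopy below: `max 0 (1 - s |x|)`. -/
def cutoff (s x : ℝ) : ℝ := max 0 (1 - s * |x|)

/-- A homotopy, for `s ∈ [0, 1]`, from the Cayley transform `(x - i) / (x + i)` to a function which
is equal to `1` for `|x| ≥ 1`. -/
def cayleySymbol (s x : ℝ) : ℂ := (x - cutoff s x * Complex.I) / (x + cutoff s x * Complex.I)

theorem cutoff_nonneg (s x : ℝ) : 0 ≤ cutoff s x := le_max_left _ _

theorem abs_le_norm_add_mul_I (x y : ℝ) : |x| ≤ ‖(x + y * Complex.I : ℂ)‖ := by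
  simpa using Complex.abs_re_le_norm (x + y * Complex.I)

theorem abs_le_norm_add_mul_I' (x y : ℝ) : |y| ≤ ‖(x + y * Complex.I : ℂ)‖ := by
  simpa using Complex.abs_im_le_norm (x + y * Complex.I)

/-- Either `|x| ≥ 1/2`, or the cutoff is at least `1 - |x| ≥ 1/2`. -/
theorem half_le_norm_add_cutoff {s : ℝ} (hs : s ≤ 1) (x : ℝ) :
    1 / 2 ≤ ‖(x + cutoff s x * Complex.I : ℂ)‖ := by
  rcases le_total (1 / 2) |x| with h | h
  · exact h.trans (abs_le_norm_add_mul_I _ _)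
  · refine le_trans ?_ (abs_le_norm_add_mul_I' x (cutoff s x))
    rw [abs_of_nonneg (cutoff_nonneg s x)]
    refine le_trans ?_ (le_max_right _ _)
    nlinarith [abs_nonneg x]

theorem add_cutoff_ne_zero {s : ℝ} (hs : s ≤ 1) (x : ℝ) :
    (x + cutoff s x * Complex.I : ℂ) ≠ 0 := by
  rw [← norm_pos_iff]
  linarith [half_le_norm_add_cutoff hs x]

theorem norm_cayleySymbol {s : ℝ} (hs : s ≤ 1) (x : ℝ) : ‖cayleySymbol s x‖ = 1 := by
  have : (x - cutoff s x * Complex.I : ℂ) = (starRingEnd ℂ) (x + cutoff s x * Complex.I) := by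
    simp [sub_eq_add_neg]
  rw [cayleySymbol, norm_div, this, RCLike.norm_conj, div_self]
  exact norm_ne_zero_iff.mpr (add_cutoff_ne_zero hs x)

theorem cayleySymbol_zero (x : ℝ) : cayleySymbol 0 x = (x - Complex.I) / (x + Complex.I) := by
  simp [cayleySymbol, cutoff]

theorem cutoff_one_of_one_le {x : ℝ} (hx : 1 ≤ |x|) : cutoff 1 x = 0 := by
  rw [cutoff, one_mul]
  exact max_eq_left (by linarith)

theorem cayleySymbol_one_of_one_le {x : ℝ} (hx : 1 ≤ |x|) : cayleySymbol 1 x = 1 := by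
  have hx0 : (x : ℂ) ≠ 0 := by
    rw [Complex.ofReal_ne_zero, ← abs_pos]; linarith
  simp [cayleySymbol, cutoff_one_of_one_le hx, hx0]

theorem cayleySymbol_one_zero : cayleySymbol 1 0 = -1 := by
  simp [cayleySymbol, cutoff]

theorem im_cayleySymbol (s x : ℝ) :
    (cayleySymbol s x).im = -2 * x * cutoff s x / Complex.normSq (x + cutoff s x * Complex.I) := by
  rw [cayleySymbol, Complex.div_im]
  simp
  ring

theorem one_le_norm_cayleySymbol_add_one {s : ℝ} (hs0 : 0 ≤ s) (hs : s ≤ 1) {x : ℝ}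
    (hx : 1 ≤ |x|) : 1 ≤ ‖cayleySymbol s x + 1‖ := by
  have hne := add_cutoff_ne_zero hs x
  have e : cayleySymbol s x + 1 = 2 * x / (x + cutoff s x * Complex.I) := by
    rw [cayleySymbol, div_add_one hne]
    ring
  rw [e, norm_div, one_le_div (norm_pos_iff.mpr hne), norm_mul, Complex.norm_real]
  refine (norm_add_le _ _).trans ?_
  rw [norm_mul, Complex.norm_I, mul_one, Complex.norm_real, Complex.norm_real, Real.norm_eq_abs,
    Real.norm_eq_abs, abs_of_nonneg (cutoff_nonneg s x), Complex.norm_ofNat]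
  have : cutoff s x ≤ 1 := max_le zero_le_one (by nlinarith [abs_nonneg x])
  linarith

/-- Norm continuity of the diagonal operators needs a bound uniform over the unbounded spectrum. The
numerator of the difference can grow like `|x x'| |s - s'|`, but the denominators `D`, `D'` dominate
`|x|`, `|x'|` and are at least `1/2`. -/
theorem norm_cayleySymbol_sub_le {s s' : ℝ} (hs : s ∈ Icc (0 : ℝ) 1) (hs' : s' ∈ Icc (0 : ℝ) 1)
    (x x' : ℝ) :
    ‖cayleySymbol s x - cayleySymbol s' x'‖ ≤ 8 * (|s - s'| + |x - x'|) := by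
  set a := cutoff s x with ha
  set a' := cutoff s' x' with ha'
  set D := ‖(x + a * Complex.I : ℂ)‖ with hD
  set D' := ‖(x' + a' * Complex.I : ℂ)‖ with hD'
  have hne : (x + a * Complex.I : ℂ) ≠ 0 := add_cutoff_ne_zero hs.2 x
  have hne' : (x' + a' * Complex.I : ℂ) ≠ 0 := add_cutoff_ne_zero hs'.2 x'
  have hD2 : 1 / 2 ≤ D := half_le_norm_add_cutoff hs.2 x
  have hD2' : 1 / 2 ≤ D' := half_le_norm_add_cutoff hs'.2 x'
  have hxD : |x| ≤ D := abs_le_norm_add_mul_I _ _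
  have hxD' : |x'| ≤ D' := abs_le_norm_add_mul_I _ _
  have haD : a ≤ D := (le_abs_self a).trans (abs_le_norm_add_mul_I' _ _)
  have ha0 : 0 ≤ a := cutoff_nonneg _ _
  have e : cayleySymbol s x - cayleySymbol s' x' =
      2 * Complex.I * ((x * a' - a * x' : ℝ) : ℂ) /
        ((x + a * Complex.I) * (x' + a' * Complex.I)) := by
    rw [cayleySymbol, cayleySymbol, div_sub_div _ _ hne hne']
    congr 1
    push_cast
    ring
  have haa : |a' - a| ≤ |s - s'| * |x'| + |x - x'| := by
    have h1 : |a' - a| ≤ |(1 - s' * |x'|) - (1 - s * |x|)| := by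
      rw [ha, ha', cutoff, cutoff, max_comm 0, max_comm 0]
      exact abs_max_sub_max_le_abs _ _ _
    have h2 : (1 - s' * |x'|) - (1 - s * |x|) = (s - s') * |x'| + s * (|x| - |x'|) := by ring
    have h3 : |s * (|x| - |x'|)| ≤ |x - x'| := by
      rw [abs_mul, abs_of_nonneg hs.1]
      exact (mul_le_of_le_one_left (abs_nonneg _) hs.2).trans (abs_abs_sub_abs_le_abs_sub x x')
    rw [h2] at h1
    refine (h1.trans (abs_add_le _ _)).trans ?_
    rw [abs_mul, abs_abs]
    linarith
  have hnum : |x * a' - a * x'| ≤ D * D' * |s - s'| + 2 * (D * |x - x'|) := by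
    have h1 : x * a' - a * x' = x * (a' - a) + a * (x - x') := by ring
    rw [h1]
    refine (abs_add_le _ _).trans ?_
    rw [abs_mul, abs_mul, abs_of_nonneg ha0]
    have h2 : |x| * |a' - a| ≤ D * (|s - s'| * D' + |x - x'|) := by
      refine mul_le_mul hxD (haa.trans ?_) (abs_nonneg _) (by linarith)
      have := mul_le_mul_of_nonneg_left hxD' (abs_nonneg (s - s'))
      linarith
    have h3 : a * |x - x'| ≤ D * |x - x'| := mul_le_mul_of_nonneg_right haD (abs_nonneg _)
    linarith
  have hDD : 0 < D * D' := by positivity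
  rw [e, norm_div, norm_mul, norm_mul, norm_mul, Complex.norm_I, Complex.norm_real,
    Complex.norm_ofNat, Real.norm_eq_abs, mul_one, div_le_iff₀ hDD]
  have h4 : D * |x - x'| ≤ 2 * (D * D' * |x - x'|) := by
    have : 0 ≤ D * |x - x'| := by positivity
    nlinarith
  have h5 : 0 ≤ D * D' * |s - s'| := by positivity
  nlinarith

end Symbol

/-! ### The homotopy of unitary operators -/

section Homotopy

/-- The operator `cayleySymbol s` applied to `twistedOperator θ`. -/
def cayleyHomotopy (s θ : ℝ) : L2I →L[ℂ] L2I :=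
  diagOp (twistedBasis θ) fun k => cayleySymbol s (twistedEigenvalue θ k)

theorem repr_cayleyHomotopy {s : ℝ} (hs : s ≤ 1) (θ : ℝ) (x : L2I) (k : ℤ) :
    (twistedBasis θ).repr (cayleyHomotopy s θ x) k =
      cayleySymbol s (twistedEigenvalue θ k) * (twistedBasis θ).repr x k :=
  repr_diagOp (fun _ => (norm_cayleySymbol hs _).le) x k

theorem cayleyHomotopy_zero (θ : ℝ) : cayleyHomotopy 0 θ = cayley (twistedOperator θ) := by
  rw [(isDiagonal_twistedOperator θ).cayley_eq, cayleyHomotopy]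
  simp_rw [cayleySymbol_zero]

theorem continuous_cayleyHomotopy {X : Type*} [TopologicalSpace X] {s θ : X → ℝ}
    (hs : Continuous s) (hs' : ∀ p, s p ∈ Icc (0 : ℝ) 1) (hθ : Continuous θ) :
    Continuous fun p => cayleyHomotopy (s p) (θ p) := by
  refine continuous_diagOp_twistedBasis hθ (fun p k => (norm_cayleySymbol (hs' p).2 _).le)
    fun p ε hε => ?_
  have h1 : Filter.Tendsto (fun q => 8 * (|s q - s p| + |θ q - θ p|)) (𝓝 p) (𝓝 0) := by
    have : Continuous fun q => 8 * (|s q - s p| + |θ q - θ p|) := by fun_prop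
    simpa using this.tendsto p
  filter_upwards [h1.eventually (gt_mem_nhds hε)] with q hq k
  refine (norm_cayleySymbol_sub_le (hs' q) (hs' p) _ _).trans (le_trans (le_of_eq ?_) hq.le)
  simp [twistedEigenvalue]

theorem cayleyHomotopy_mem_unitary {s : ℝ} (hs : s ≤ 1) (θ : ℝ) :
    cayleyHomotopy s θ ∈ unitary (L2I →L[ℂ] L2I) := by
  refine mem_unitary_of_norm_map_of_surjective (fun x => ?_) fun y => ?_
  · refine norm_eq_of_repr (b := twistedBasis θ) fun k => ?_
    rw [repr_cayleyHomotopy hs, norm_mul, norm_cayleySymbol hs, one_mul]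
  · refine ⟨diagOp (twistedBasis θ) (fun k => (cayleySymbol s (twistedEigenvalue θ k))⁻¹) y,
      repr_ext (b := twistedBasis θ) fun k => ?_⟩
    have hne : cayleySymbol s (twistedEigenvalue θ k) ≠ 0 := by
      rw [← norm_ne_zero_iff, norm_cayleySymbol hs]; exact one_ne_zero
    rw [repr_cayleyHomotopy hs, repr_diagOp (K := 1) (fun k => by
      rw [norm_inv, norm_cayleySymbol hs, inv_one]), mul_inv_cancel_left₀ hne]

theorem le_abs_twistedEigenvalue (θ : ℝ) {k : ℤ} (hk : k ≠ 0) :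
    2 * Real.pi - |θ| ≤ |twistedEigenvalue θ k| := by
  have hpi := Real.pi_pos
  have h1 : (1 : ℝ) ≤ |(k : ℝ)| := by exact_mod_cast Int.one_le_abs hk
  have h2 : |2 * Real.pi * k| = 2 * Real.pi * |(k : ℝ)| := by
    rw [abs_mul, abs_of_pos (by positivity)]
  have h4 := abs_sub_abs_le_abs_sub (2 * Real.pi * k) θ
  rw [abs_sub_comm] at h4
  rw [twistedEigenvalue]
  nlinarith

theorem one_le_abs_twistedEigenvalue {θ : ℝ} (hθ : θ ∈ Icc (-Real.pi) Real.pi) {k : ℤ}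
    (hk : k ≠ 0) : 1 ≤ |twistedEigenvalue θ k| := by
  linarith [Real.pi_gt_three, le_abs_twistedEigenvalue θ hk, abs_le.mpr hθ]

/-- For `|θ| ≤ π` every eigenvalue with `k ≠ 0` has modulus at least `1`, where the symbol stays at
distance at least `1` from `-1`. -/
theorem isBoundedBelowOff_cayleyHomotopy {s θ : ℝ} (hs : s ∈ Icc (0 : ℝ) 1)
    (hθ : θ ∈ Icc (-Real.pi) Real.pi) :
    IsBoundedBelowOff (Submodule.span ℂ {twistedBasis θ 0}) 1 (cayleyHomotopy s θ) := by
  intro x hx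
  have h0 : (twistedBasis θ).repr x 0 = 0 := by
    rw [HilbertBasis.repr_apply_apply]
    exact (Submodule.mem_orthogonal _ _).mp hx _ (Submodule.mem_span_singleton_self _)
  rw [one_mul, ← one_mul ‖_ + x‖]
  refine norm_le_of_repr (b := twistedBasis θ) zero_le_one fun k => ?_
  rw [map_add, lp.coeFn_add, Pi.add_apply, repr_cayleyHomotopy hs.2, one_mul, ← add_one_mul,
    norm_mul]
  rcases eq_or_ne k 0 with rfl | hk
  · simp [h0]
  · exact le_mul_of_one_le_left (norm_nonneg _)
      (one_le_norm_cayleySymbol_add_one hs.1 hs.2 (one_le_abs_twistedEigenvalue hθ hk))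

/-- The shift `k ↦ k + 1` matches both eigenvectors and eigenvalues, as `-π - 2πk = π - 2π(k + 1)`.
So each stage of the homotopy is again a loop. -/
theorem cayleyHomotopy_neg_pi {s : ℝ} (hs : s ≤ 1) :
    cayleyHomotopy s (-Real.pi) = cayleyHomotopy s Real.pi := by
  symm
  have hshift : ∀ x k, (twistedBasis (-Real.pi)).repr x k =
      (twistedBasis Real.pi).repr x (k + 1) := fun x k => by
    rw [HilbertBasis.repr_apply_apply, HilbertBasis.repr_apply_apply, twistedBasis_apply,
      twistedBasis_apply]
    congr 2
    push_cast; ring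
  refine eq_diagOp (fun k => (norm_cayleySymbol hs _).le) fun x k => ?_
  rw [hshift, hshift, repr_cayleyHomotopy hs]
  congr 2
  simp only [twistedEigenvalue]
  push_cast; ring

/-- At `s = 1` the symbol `ζ` differs from `1` at most on the vector with `k = 0`. Hence `(U + a)⁻¹`
is `(1 + a)⁻¹` times a rank-one perturbation of the identity, whose coefficient `β` solves `1 + β =
(1 + a) / (ζ + a)`. -/
theorem compressionDet_cayleyHomotopy_one (V : Submodule ℂ L2I) [FiniteDimensional ℂ V] {a : ℝ}
    (h0 : 0 ≤ a) (h1 : a < 1) {θ : ℝ} (hθ : θ ∈ Icc (-Real.pi) Real.pi) :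
    compressionDet V a (cayleyHomotopy 1 θ) = ((1 + a : ℂ)⁻¹) ^ Module.finrank ℂ V *
      (1 + (1 - cayleySymbol 1 θ) / (cayleySymbol 1 θ + a) *
        ‖V.orthogonalProjectionOnto (twistedBasis θ 0)‖ ^ 2) := by
  classical
  have hlow : ∀ x, 1 - a ≤ ‖cayleySymbol 1 x + a‖ := fun x => by
    have h2 := norm_sub_le (cayleySymbol 1 x + a) (a : ℂ)
    rw [add_sub_cancel_right, norm_cayleySymbol le_rfl, Complex.norm_real, Real.norm_eq_abs,
      abs_of_nonneg h0] at h2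
    linarith
  have hne : ∀ x, cayleySymbol 1 x + a ≠ 0 := fun x => by
    rw [← norm_pos_iff]; linarith [hlow x]
  have hne1 : (1 + a : ℂ) ≠ 0 := by
    norm_cast; positivity
  have hc : ∀ k, ‖(cayleySymbol 1 (twistedEigenvalue θ k) + a)⁻¹‖ ≤ (1 - a)⁻¹ := fun k => by
    rw [norm_inv]; exact inv_anti₀ (by linarith) (hlow _)
  set R := diagOp (twistedBasis θ) fun k => (cayleySymbol 1 (twistedEigenvalue θ k) + a)⁻¹ with hR
  have hUa : ∀ x k, (twistedBasis θ).repr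
      ((cayleyHomotopy 1 θ + (a : ℂ) • (1 : L2I →L[ℂ] L2I)) x) k =
        (cayleySymbol 1 (twistedEigenvalue θ k) + a) * (twistedBasis θ).repr x k := fun x k => by
    simp only [add_apply, smul_apply, one_apply_eq_self, map_add, map_smul, lp.coeFn_add,
      lp.coeFn_smul, Pi.add_apply, Pi.smul_apply, smul_eq_mul, repr_cayleyHomotopy le_rfl]
    ring
  refine compressionDet_eq V (R := R) ?_ ?_ fun x => ?_
  · ext1 x
    refine repr_ext (b := twistedBasis θ) fun k => ?_
    rw [mul_apply_eq_comp, hUa, hR, repr_diagOp hc,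
      mul_inv_cancel_left₀ (hne _), one_apply_eq_self]
  · ext1 x
    refine repr_ext (b := twistedBasis θ) fun k => ?_
    rw [mul_apply_eq_comp, hR, repr_diagOp hc, hUa,
      inv_mul_cancel_left₀ (hne _), one_apply_eq_self]
  · refine repr_ext (b := twistedBasis θ) fun k => ?_
    rw [hR, repr_diagOp hc]
    simp only [map_add, map_smul, lp.coeFn_add, lp.coeFn_smul, Pi.add_apply, Pi.smul_apply,
      smul_eq_mul, HilbertBasis.repr_self]
    rcases eq_or_ne k 0 with rfl | hk
    · have e0 : twistedEigenvalue θ 0 = θ := by simp [twistedEigenvalue]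
      rw [e0, lp.single_apply_self, ← HilbertBasis.repr_apply_apply]
      have := hne θ
      field_simp
      ring
    · rw [lp.single_apply_ne _ _ _ hk, cayleySymbol_one_of_one_le
        (one_le_abs_twistedEigenvalue hθ hk)]
      simp

end Homotopy

/-! ### The loop is not null-homotopic -/

section Loop

theorem HasClosedLog.of_const_mul {γ : I → ℂ} {c : ℂ} (hc : c ≠ 0)
    (h : HasClosedLog fun t => c * γ t) : HasClosedLog γ := by
  obtain ⟨φ, hφ, hφe, hφ1⟩ := h
  refine ⟨fun t => φ t - Complex.log c, by fun_prop, fun t => ?_, by simp only [hφ1]⟩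
  rw [Complex.exp_sub, hφe, Complex.exp_log hc, mul_div_cancel_left₀ _ hc]

theorem im_one_sub_div_add (ζ : ℂ) (a : ℝ) :
    ((1 - ζ) / (ζ + a)).im = -((1 + a) * ζ.im) / Complex.normSq (ζ + a) := by
  rw [Complex.div_im]
  simp
  ring

theorem cayleySymbol_one_im_pos_or (x : ℝ) :
    (∃ y > 0, (cayleySymbol 1 x).im = -x * y) ∨ cayleySymbol 1 x = 1 := by
  rcases le_or_gt 1 |x| with h | h
  · exact Or.inr (cayleySymbol_one_of_one_le h)
  · left
    have h1 : 0 < cutoff 1 x := lt_max_of_lt_right (by rw [one_mul]; linarith)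
    have h2 : 0 < Complex.normSq (x + cutoff 1 x * Complex.I) :=
      Complex.normSq_pos.mpr (add_cutoff_ne_zero le_rfl x)
    refine ⟨2 * cutoff 1 x / Complex.normSq (x + cutoff 1 x * Complex.I), by positivity, ?_⟩
    rw [im_cayleySymbol]
    ring

/-- The factor by which `compressionDet` varies along the last loop of the homotopy turns once
around the origin. -/
theorem not_hasClosedLog_compression {a : ℝ} (h0 : 0 ≤ a) (h1 : a < 1) {q : ℝ → ℝ}
    (hq : ∀ θ, 0 ≤ q θ) (hq0 : q 0 = 1) :
    ¬ HasClosedLog fun t : I =>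
      let θ := -Real.pi + t * (Real.pi - -Real.pi)
      1 + (1 - cayleySymbol 1 θ) / (cayleySymbol 1 θ + a) * (q θ : ℂ) := by
  have hpi := Real.pi_gt_three
  -- Wherever the value is not `1`, its imaginary part has the sign of `θ`: lower half plane first,
  -- upper half plane afterwards.
  have key : ∀ θ : ℝ, (∃ y > 0, (1 + (1 - cayleySymbol 1 θ) / (cayleySymbol 1 θ + a) *
      (q θ : ℂ)).im = θ * y) ∨
      1 + (1 - cayleySymbol 1 θ) / (cayleySymbol 1 θ + a) * (q θ : ℂ) = 1 := by
    intro θ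
    have hne : cayleySymbol 1 θ + a ≠ 0 := by
      intro h
      have h2 := congrArg norm (eq_neg_of_add_eq_zero_left h)
      rw [norm_cayleySymbol le_rfl, norm_neg, Complex.norm_real, Real.norm_eq_abs,
        abs_of_nonneg h0] at h2
      linarith
    rcases (hq θ).eq_or_lt with hq' | hq'
    · right; simp [← hq']
    rcases cayleySymbol_one_im_pos_or θ with ⟨y, hy, h⟩ | h
    · left
      have hN := Complex.normSq_pos.mpr hne
      refine ⟨(1 + a) * y * q θ / Complex.normSq (cayleySymbol 1 θ + a), by positivity, ?_⟩
      rw [Complex.add_im, Complex.one_im, Complex.im_mul_ofReal, im_one_sub_div_add, h]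
      ring
    · right; simp [h]
  have hpiabs : (1 : ℝ) ≤ |Real.pi| := by rw [abs_of_pos Real.pi_pos]; linarith
  refine not_hasClosedLog (m := ⟨1 / 2, by norm_num, by norm_num⟩) ?_ ?_ ?_ (fun t ht => ?_)
    fun t ht => ?_
  · simp [cayleySymbol_one_of_one_le (x := -Real.pi) (by rwa [abs_neg])]
  · have e : -Real.pi + ((1 : I) : ℝ) * (Real.pi - -Real.pi) = Real.pi := by simp
    simp only [e, cayleySymbol_one_of_one_le hpiabs]
    simp
  · have e : -Real.pi + (1 / 2) * (Real.pi - -Real.pi) = 0 := by ring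
    -- At `θ = 0` the symbol is `-1`, and `q 0 = 1` makes the value a negative real, as `a < 1`.
    have e2 : (1 + (1 - (-1 : ℂ)) / (-1 + a) * ((1 : ℝ) : ℂ)) = (((1 + a) / (a - 1) : ℝ) : ℂ) := by
      have : (a : ℂ) - 1 ≠ 0 := by
        norm_cast; linarith
      have h3 : (-1 + a : ℂ) ≠ 0 := by rwa [neg_add_eq_sub]
      push_cast
      field_simp
      ring
    simp only [e, cayleySymbol_one_zero, hq0, e2]
    refine ⟨Complex.ofReal_im _, ?_⟩
    rw [Complex.ofReal_re]
    exact div_neg_of_pos_of_neg (by linarith) (by linarith)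
  · have ht' : (t : ℝ) < 1 / 2 := ht
    refine (key _).imp_left ?_
    rintro ⟨y, hy, h⟩
    simp only [h]
    exact mul_neg_of_neg_of_pos (by nlinarith) hy
  · have ht' : (1 / 2 : ℝ) < t := ht
    refine (key _).imp_left ?_
    rintro ⟨y, hy, h⟩
    simp only [h]
    exact mul_pos (by nlinarith) hy

theorem continuous_cayley {H : Type*} [NormedAddCommGroup H] [InnerProductSpace ℂ H]
    [CompleteSpace H] : Continuous fun T : SelfAdjointFredholm H => cayley T.toLinearPMap :=
  (Isometry.of_dist_eq fun S T => by
    rw [dist_eq_norm, SelfAdjointFredholm.dist_eq]).continuous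

theorem theta_mem_Icc (t : I) : -Real.pi + t * (Real.pi - -Real.pi) ∈ Icc (-Real.pi) Real.pi := by
  have hpi := Real.pi_pos
  have h0 := t.2.1
  have h1 := t.2.2
  constructor <;> nlinarith

theorem not_homotopic_refl (A : C(Icc (-Real.pi) Real.pi, SelfAdjointFredholm L2I))
    (hA : ∀ s, (A s).toLinearPMap = twistedOperator (s : ℝ))
    (hab : -Real.pi ≤ Real.pi)
    (hclosed : A ⟨-Real.pi, left_mem_Icc.mpr hab⟩ = A ⟨Real.pi, right_mem_Icc.mpr hab⟩) :
    ¬ (loopOfClosedPath hab A hclosed).Homotopic (Path.refl _) := by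
  rintro ⟨F⟩
  let θ : I → ℝ := fun t => -Real.pi + t * (Real.pi - -Real.pi)
  let U₁ : I × I → L2I →L[ℂ] L2I := fun p => cayley (F p).toLinearPMap
  -- Time is reversed so that the end of `U₂` is the beginning of `U₁`; closed logarithms then
  -- travel from the constant loop back to the explicit one.
  let U₂ : I × I → L2I →L[ℂ] L2I := fun p => cayleyHomotopy (1 - p.1) (θ p.2)
  have hmem : ∀ p : I × I, (1 - p.1 : ℝ) ∈ Icc (0 : ℝ) 1 := fun p =>
    ⟨by linarith [p.1.2.2], by linarith [p.1.2.1]⟩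
  have hU₁ : Continuous U₁ := continuous_cayley.comp F.continuous
  have hU₂ : Continuous U₂ := continuous_cayleyHomotopy (by fun_prop) hmem (by fun_prop)
  have hu₁ : ∀ p, U₁ p ∈ unitary (L2I →L[ℂ] L2I) := fun p => cayley_mem_unitary (F p).2.1
  have hu₂ : ∀ p, U₂ p ∈ unitary (L2I →L[ℂ] L2I) := fun p =>
    cayleyHomotopy_mem_unitary (hmem p).2 _
  obtain ⟨V₀, hV₀, c, hc, hbd⟩ := exists_isBoundedBelowOff
    ((isCompact_range hU₁).union (isCompact_range hU₂)) (by
      rintro _ (⟨p, rfl⟩ | ⟨p, rfl⟩)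
      · exact exists_isBoundedBelowOff_cayley (F p).2.1 (F p).2.2
      · exact ⟨_, inferInstance, 1, one_pos,
          isBoundedBelowOff_cayleyHomotopy (hmem p) (theta_mem_Icc _)⟩)
  -- The extra vector makes the projection of the crossing eigenvector have norm one at `θ = 0`.
  let V := V₀ ⊔ Submodule.span ℂ {twistedBasis 0 0}
  have hbd₁ : ∀ p, IsBoundedBelowOff V c (U₁ p) := fun p =>
    (hbd _ (Or.inl ⟨p, rfl⟩)).mono le_sup_left le_rfl
  have hbd₂ : ∀ p, IsBoundedBelowOff V c (U₂ p) := fun p =>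
    (hbd _ (Or.inr ⟨p, rfl⟩)).mono le_sup_left le_rfl
  obtain ⟨a, ha0, ha1, hac⟩ : ∃ a : ℝ, 0 ≤ a ∧ a < 1 ∧ 1 - c ^ 2 / 2 < a := by
    have hc2 : 0 < c ^ 2 := by positivity
    refine ⟨max 0 (1 - c ^ 2 / 4), le_max_left _ _, max_lt one_pos (by linarith), ?_⟩
    exact lt_max_of_lt_right (by linarith)
  have hF0 : ∀ t, U₁ (0, t) = U₂ (1, t) := fun t => by
    have h1 : F (0, t) = loopOfClosedPath hab A hclosed t := F.apply_zero t
    have h2 : (F (0, t)).toLinearPMap = twistedOperator (θ t) := by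
      rw [h1]; exact hA _
    simp only [U₁, U₂]
    rw [h2]
    simp [cayleyHomotopy_zero]
  have hF1 : ∀ t, F (1, t) = A ⟨-Real.pi, left_mem_Icc.mpr hab⟩ := fun t => F.apply_one t
  have hlog₁ : HasClosedLog fun t => compressionDet V a (U₁ (0, t)) := by
    refine HasClosedLog.of_homotopy (G := fun p => compressionDet V a (U₁ p))
      (continuous_compressionDet V ha0 ha1 hU₁ hu₁)
      (fun p => compressionDet_ne_zero V ha0 ha1 hc.le hac (hu₁ p) (hbd₁ p)) (fun s => ?_) ?_
    · simp only [U₁]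
      rw [F.source, F.target]
    · have : (fun t => compressionDet V a (U₁ (1, t))) = fun _ => compressionDet V a (U₁ (1, 0)) := by
        ext1 t
        simp only [U₁, hF1]
      rw [this]
      exact hasClosedLog_const (compressionDet_ne_zero V ha0 ha1 hc.le hac (hu₁ _) (hbd₁ _))
  have hlog₂ : HasClosedLog fun t => compressionDet V a (U₂ (0, t)) := by
    refine HasClosedLog.of_homotopy (G := fun p => compressionDet V a (U₂ p))
      (continuous_compressionDet V ha0 ha1 hU₂ hu₂)
      (fun p => compressionDet_ne_zero V ha0 ha1 hc.le hac (hu₂ p) (hbd₂ p)) (fun s => ?_) ?_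
    · have e0 : θ 0 = -Real.pi := by simp [θ]
      have e1 : θ 1 = Real.pi := by simp [θ]
      simp only [U₂, e0, e1]
      rw [cayleyHomotopy_neg_pi (hmem (s, 0)).2]
    · simpa only [hF0] using hlog₁
  have hne : ((1 + a : ℂ)⁻¹) ^ Module.finrank ℂ V ≠ 0 := by
    refine pow_ne_zero _ (inv_ne_zero ?_)
    norm_cast; positivity
  refine not_hasClosedLog_compression ha0 ha1
    (q := fun x => ‖V.orthogonalProjectionOnto (twistedBasis x 0)‖ ^ 2) (fun _ => by positivity) ?_
    (HasClosedLog.of_const_mul hne ?_)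
  · have he : twistedBasis 0 0 ∈ V :=
      (le_sup_right : _ ≤ V) (Submodule.mem_span_singleton_self _)
    rw [Submodule.norm_orthogonalProjectionOnto_apply _ he, (twistedBasis 0).orthonormal.1, one_pow]
  · have e : (fun t => compressionDet V a (U₂ (0, t))) = fun t : I =>
        ((1 + a : ℂ)⁻¹) ^ Module.finrank ℂ V *
          (1 + (1 - cayleySymbol 1 (θ t)) / (cayleySymbol 1 (θ t) + a) *
            (‖V.orthogonalProjectionOnto (twistedBasis (θ t) 0)‖ : ℂ) ^ 2) := by
      ext1 t
      have e1 : U₂ (0, t) = cayleyHomotopy 1 (θ t) := by simp [U₂]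
      rw [e1]
      exact compressionDet_cayleyHomotopy_one V ha0 ha1 (theta_mem_Icc t)
    rw [e] at hlog₂
    simp only [Complex.ofReal_pow]
    exact hlog₂

end Loop

/-! ### The spectral flow of the loop -/

section Partition

/-- The condition `0 ≤ θ - 2πk ≤ r` says that `k` lies between `(θ - r)/2π` and `θ/2π`. -/
theorem finrank_eigenspaceSum_twistedOperator (θ : ℝ) {r : ℝ} (hr : 0 < r) :
    (Module.finrank ℂ (eigenspaceSum (twistedOperator θ) 0 r) : ℤ) =
      ⌊θ / (2 * Real.pi)⌋ + 1 - ⌈(θ - r) / (2 * Real.pi)⌉ := by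
  have hpi : 0 < 2 * Real.pi := by positivity
  have hs : ∀ k, k ∈ Finset.Icc ⌈(θ - r) / (2 * Real.pi)⌉ ⌊θ / (2 * Real.pi)⌋ ↔
      twistedEigenvalue θ k ∈ Icc 0 r := by
    intro k
    rw [Finset.mem_Icc, Int.ceil_le, Int.le_floor, div_le_iff₀ hpi, le_div_iff₀ hpi, mem_Icc,
      twistedEigenvalue]
    constructor <;> rintro ⟨h1, h2⟩ <;> constructor <;> linarith
  rw [(isDiagonal_twistedOperator θ).eigenspaceSum_eq hs, finrank_span_basis, Int.card_Icc,
    Int.toNat_of_nonneg]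
  have : ⌈(θ - r) / (2 * Real.pi)⌉ ≤ ⌊θ / (2 * Real.pi)⌋ + 1 := by
    rw [Int.ceil_le]
    push_cast
    refine le_trans ?_ (Int.lt_floor_add_one _).le
    exact div_le_div_of_nonneg_right (by linarith) hpi.le
  linarith

/-- If the ceiling jumped past `n`, the parameter `r + 2πn` would lie in the interval, and there `r`
is the `n`-th eigenvalue. -/
theorem ceil_eq_of_mem_resolventSet {θ θ' r : ℝ} (hle : θ ≤ θ')
    (h : ∀ s ∈ Icc θ θ', (r : ℂ) ∈ resolventSet (twistedOperator s)) :
    ⌈(θ - r) / (2 * Real.pi)⌉ = ⌈(θ' - r) / (2 * Real.pi)⌉ := by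
  have hpi : 0 < 2 * Real.pi := by positivity
  refine le_antisymm (Int.ceil_mono (div_le_div_of_nonneg_right (by linarith) hpi.le)) ?_
  by_contra hlt
  rw [not_le, Int.lt_ceil, lt_div_iff₀ hpi] at hlt
  set n := ⌈(θ - r) / (2 * Real.pi)⌉
  have h1 : (θ - r) / (2 * Real.pi) ≤ n := Int.le_ceil _
  rw [div_le_iff₀ hpi] at h1
  have h2 := (isDiagonal_twistedOperator (r + n * (2 * Real.pi))).notMem_resolventSet n
  rw [show twistedEigenvalue (r + n * (2 * Real.pi)) n = r by rw [twistedEigenvalue]; ring] at h2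
  exact h2 (h _ ⟨by linarith, by linarith⟩)

theorem sum_fin_sub {n : ℕ} (f : Fin (n + 1) → ℤ) :
    ∑ i : Fin n, (f i.succ - f i.castSucc) = f (Fin.last n) - f 0 := by
  have h := Fin.sum_univ_succ f
  rw [Fin.sum_univ_castSucc f] at h
  rw [Finset.sum_sub_distrib]
  linarith

variable {A : C(Icc (-Real.pi) Real.pi, SelfAdjointFredholm L2I)}

/-- On each subinterval the ceilings cancel, so `r` drops out and the floors telescope. -/
theorem SpectralPartition.value_eq_one (hA : ∀ s, (A s).toLinearPMap = twistedOperator (s : ℝ))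
    (P : SpectralPartition A) : P.value = 1 := by
  have hseg : ∀ i : Fin P.n,
      (Module.finrank ℂ (eigenspaceSum (A (P.t i.succ)).toLinearPMap 0 (P.r i)) : ℤ) -
        (Module.finrank ℂ (eigenspaceSum (A (P.t i.castSucc)).toLinearPMap 0 (P.r i)) : ℤ) =
      ⌊(P.t i.succ : ℝ) / (2 * Real.pi)⌋ - ⌊(P.t i.castSucc : ℝ) / (2 * Real.pi)⌋ := by
    intro i
    rw [hA, hA, finrank_eigenspaceSum_twistedOperator _ (P.r_pos i),
      finrank_eigenspaceSum_twistedOperator _ (P.r_pos i)]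
    have := ceil_eq_of_mem_resolventSet (θ := P.t i.castSucc) (θ' := P.t i.succ) (r := P.r i)
      (P.monotone_t (Fin.castSucc_le_succ i)) fun s hs => by
        have hs' : s ∈ Icc (-Real.pi) Real.pi :=
          ⟨(P.t i.castSucc).2.1.trans hs.1, hs.2.trans (P.t i.succ).2.2⟩
        have := (P.mem_resolventSet i ⟨s, hs'⟩ ⟨hs.1, hs.2⟩).1
        rwa [hA] at this
    linarith
  rw [SpectralPartition.value, Finset.sum_congr rfl fun i _ => hseg i,
    sum_fin_sub fun i => ⌊(P.t i : ℝ) / (2 * Real.pi)⌋, P.t_zero, P.t_last]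
  have hpi := Real.pi_ne_zero
  have e1 : Real.pi / (2 * Real.pi) = 1 / 2 := by field_simp
  have e2 : -Real.pi / (2 * Real.pi) = -(1 / 2) := by field_simp
  rw [e1, e2]
  norm_num

/-- The eigenvalues of `twistedOperator θ` keep the distance `δ` from `±r`, and those in `(-r, r)`
are the ones with index in `s`. -/
def HasSpectralGap (θ r δ : ℝ) (s : Finset ℤ) : Prop :=
  (∀ k, δ ≤ |(|twistedEigenvalue θ k| - r)|) ∧ ∀ k, k ∈ s ↔ |twistedEigenvalue θ k| < r

theorem HasSpectralGap.mem_resolventSet {θ r δ : ℝ} {s : Finset ℤ} (h : HasSpectralGap θ r δ s)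
    (hδ : 0 < δ) {z : ℂ} (hz : ‖z‖ = r) : z ∈ resolventSet (twistedOperator θ) :=
  (isDiagonal_twistedOperator θ).mem_resolventSet hδ fun k =>
    le_norm_sub_of_mem_sphere (h.1 k) (mem_sphere_zero_iff_norm.mpr hz)

theorem HasSpectralGap.spectralProjection_eq {θ r δ : ℝ} {s : Finset ℤ}
    (h : HasSpectralGap θ r δ s) (hr : 0 < r) (hδ : 0 < δ) :
    spectralProjection (twistedOperator θ) (-r) r =
      diagOp (twistedBasis θ) fun k => if k ∈ s then 1 else 0 := by
  rw [(isDiagonal_twistedOperator θ).spectralProjection_eq hr hδ h.1]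
  simp_rw [h.2]

theorem HasSpectralGap.range_spectralProjection {θ r δ : ℝ} {s : Finset ℤ}
    (h : HasSpectralGap θ r δ s) (hr : 0 < r) (hδ : 0 < δ) :
    LinearMap.range (spectralProjection (twistedOperator θ) (-r) r : L2I →ₗ[ℂ] L2I) =
      Submodule.span ℂ (twistedBasis θ '' s) := by
  rw [h.spectralProjection_eq hr hδ]
  exact range_diagOp_indicator (twistedBasis θ) s fun _ => Iff.rfl

/-- A partition with a spectral gap on each subinterval is a spectral partition. -/
def spectralPartitionOfGap (hA : ∀ s, (A s).toLinearPMap = twistedOperator (s : ℝ)) {n : ℕ}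
    (t : Fin (n + 1) → Icc (-Real.pi) Real.pi) (r : Fin n → ℝ) (s : Fin n → Finset ℤ) {δ : ℝ}
    (hδ : 0 < δ) (ht : Monotone t) (h0 : (t 0 : ℝ) = -Real.pi) (h1 : (t (Fin.last n) : ℝ) = Real.pi)
    (hr : ∀ i, 0 < r i)
    (hgap : ∀ i, ∀ x ∈ Icc (t i.castSucc) (t i.succ), HasSpectralGap x (r i) δ (s i)) :
    SpectralPartition A where
  n := n
  t := t
  r := r
  monotone_t := ht
  t_zero := h0
  t_last := h1
  r_pos := hr
  mem_resolventSet i x hx := by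
    rw [hA]
    exact ⟨(hgap i x hx).mem_resolventSet hδ (by simp [abs_of_pos (hr i)]),
      (hgap i x hx).mem_resolventSet hδ (by simp [abs_of_pos (hr i)])⟩
  continuousOn i := by
    have hc : Continuous fun x : Icc (-Real.pi) Real.pi =>
        diagOp (twistedBasis x) fun k => if k ∈ s i then (1 : ℂ) else 0 :=
      continuous_diagOp_twistedBasis (K := 1) continuous_subtype_val
        (fun _ k => by split_ifs <;> simp)
        fun _ ε hε => Filter.Eventually.of_forall fun _ k => by simpa using hε.le
    refine hc.continuousOn.congr fun x hx => ?_
    simp only [hA]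
    exact (hgap i x hx).spectralProjection_eq (hr i) hδ
  finite_rank i x hx := by
    rw [hA, (hgap i x hx).range_spectralProjection (hr i) hδ]
    exact FiniteDimensional.span_of_finite ℂ ((s i).finite_toSet.image _)
  constant_rank i x hx x' hx' := by
    rw [hA, hA, (hgap i x hx).range_spectralProjection (hr i) hδ,
      (hgap i x' hx').range_spectralProjection (hr i) hδ, finrank_span_basis, finrank_span_basis]

theorem hasSpectralGap_outer {θ : ℝ} (h1 : Real.pi / 2 ≤ |θ|) (h2 : |θ| ≤ Real.pi) :
    HasSpectralGap θ (Real.pi / 4) (Real.pi / 4) ∅ := by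
  have hpi := Real.pi_pos
  have h : ∀ k, Real.pi / 2 ≤ |twistedEigenvalue θ k| := fun k => by
    rcases eq_or_ne k 0 with rfl | hk
    · simpa [twistedEigenvalue] using h1
    · linarith [le_abs_twistedEigenvalue θ hk]
  refine ⟨fun k => le_trans (by linarith [h k]) (le_abs_self _), fun k => ?_⟩
  simp only [Finset.notMem_empty, false_iff, not_lt]
  linarith [h k]

theorem hasSpectralGap_inner {θ : ℝ} (h1 : |θ| ≤ Real.pi / 2) :
    HasSpectralGap θ Real.pi (Real.pi / 4) {0} := by
  have hpi := Real.pi_pos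
  have h0 : |twistedEigenvalue θ 0| ≤ Real.pi / 2 := by simpa [twistedEigenvalue] using h1
  have h : ∀ k, k ≠ 0 → 3 * Real.pi / 2 ≤ |twistedEigenvalue θ k| := fun k hk => by
    linarith [le_abs_twistedEigenvalue θ hk]
  refine ⟨fun k => ?_, fun k => ?_⟩ <;> rcases eq_or_ne k 0 with rfl | hk
  · exact le_trans (by linarith) (neg_le_abs _)
  · exact le_trans (by linarith [h k hk]) (le_abs_self _)
  · simpa using by linarith
  · simp only [Finset.mem_singleton, hk, false_iff, not_lt]
    linarith [h k hk]

theorem nonempty_spectralPartition (hA : ∀ s, (A s).toLinearPMap = twistedOperator (s : ℝ)) :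
    Nonempty (SpectralPartition A) := by
  have hpi := Real.pi_pos
  -- For `|θ| ≥ π/2` no eigenvalue is smaller than `π/2` in modulus, so `r = π/4` isolates nothing.
  -- For `|θ| ≤ π/2` only `k = 0` lies within `π/2` of zero and the others have modulus at least
  -- `3π/2`, so `r = π` isolates that one.
  refine ⟨spectralPartitionOfGap hA (n := 3)
    ![⟨-Real.pi, by constructor <;> linarith⟩, ⟨-(Real.pi / 2), by constructor <;> linarith⟩,
      ⟨Real.pi / 2, by constructor <;> linarith⟩, ⟨Real.pi, by constructor <;> linarith⟩]
    ![Real.pi / 4, Real.pi, Real.pi / 4] ![∅, {0}, ∅] (δ := Real.pi / 4) (by positivity)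
    ?_ rfl rfl ?_ ?_⟩
  · rw [Fin.monotone_iff_le_succ]
    intro i
    rw [← Subtype.coe_le_coe]
    fin_cases i
    · change -Real.pi ≤ -(Real.pi / 2); linarith
    · change -(Real.pi / 2) ≤ Real.pi / 2; linarith
    · change Real.pi / 2 ≤ Real.pi; linarith
  · intro i
    fin_cases i
    · exact (by positivity : 0 < Real.pi / 4)
    · exact hpi
    · exact (by positivity : 0 < Real.pi / 4)
  · intro i x hx
    fin_cases i
    · have h1 : -Real.pi ≤ (x : ℝ) := hx.1
      have h2 : (x : ℝ) ≤ -(Real.pi / 2) := hx.2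
      have h3 : |(x : ℝ)| = -x := abs_of_neg (by linarith)
      exact hasSpectralGap_outer (by rw [h3]; linarith) (by rw [h3]; linarith)
    · have h1 : -(Real.pi / 2) ≤ (x : ℝ) := hx.1
      have h2 : (x : ℝ) ≤ Real.pi / 2 := hx.2
      exact hasSpectralGap_inner (abs_le.mpr ⟨h1, h2⟩)
    · have h1 : Real.pi / 2 ≤ (x : ℝ) := hx.1
      have h2 : (x : ℝ) ≤ Real.pi := hx.2
      have h3 : |(x : ℝ)| = x := abs_of_pos (by linarith)
      exact hasSpectralGap_outer (by rw [h3]; exact h1) (by rw [h3]; exact h2)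

end Partition

/-! ### The path of twisted operators -/

theorem isFredholm_twistedOperator (θ : ℝ) : IsFredholm (twistedOperator θ) := by
  have hpi := Real.pi_gt_three
  -- For `|k| > N` one has `2π|k| - |θ| ≥ 1`, so only finitely many eigenvalues can be near zero.
  let N := ⌈|θ|⌉
  refine (isDiagonal_twistedOperator θ).isFredholm (Finset.Icc (-N) N) one_pos fun k hk => ?_
  have hN : |θ| ≤ N := Int.le_ceil _
  have hk' : (N : ℝ) + 1 ≤ |(k : ℝ)| := by
    have : N + 1 ≤ |k| := by
      by_contra hlt
      exact hk (Finset.mem_Icc.mpr (abs_le.mp (by linarith)))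
    exact_mod_cast this
  have h2 : |2 * Real.pi * k| = 2 * Real.pi * |(k : ℝ)| := by
    rw [abs_mul, abs_of_pos (by positivity)]
  have h4 := abs_sub_abs_le_abs_sub (2 * Real.pi * k) θ
  rw [abs_sub_comm] at h4
  rw [twistedEigenvalue]
  nlinarith [abs_nonneg (k : ℝ)]

/-- The operator `twistedOperator θ` as a point of `CF^sa(L²[0, 1])`. -/
def twistedFredholm (θ : ℝ) : SelfAdjointFredholm L2I :=
  ⟨twistedOperator θ, (isDiagonal_twistedOperator θ).isSelfAdjoint, isFredholm_twistedOperator θ⟩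

theorem continuous_twistedFredholm : Continuous twistedFredholm := by
  have h : Continuous fun θ : ℝ => cayleyHomotopy 0 θ :=
    continuous_cayleyHomotopy continuous_const (fun _ => left_mem_Icc.mpr zero_le_one) continuous_id
  rw [Metric.continuous_iff] at h ⊢
  intro θ ε hε
  obtain ⟨δ, hδ, h1⟩ := h θ ε hε
  refine ⟨δ, hδ, fun θ' hθ' => ?_⟩
  have h2 := h1 θ' hθ'
  rw [dist_eq_norm, cayleyHomotopy_zero, cayleyHomotopy_zero] at h2
  rw [SelfAdjointFredholm.dist_eq]
  exact h2

theorem twistedFredholm_neg_pi : twistedFredholm (-Real.pi) = twistedFredholm Real.pi := by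
  refine SelfAdjointFredholm.cayley_injective ?_
  have := cayleyHomotopy_neg_pi zero_le_one
  rwa [cayleyHomotopy_zero, cayleyHomotopy_zero] at this

end SpectralFlow

end

theorem mainTheorem12 :
    ∃ A : C(Set.Icc (-Real.pi) Real.pi, SpectralFlow.SelfAdjointFredholm SpectralFlow.L2I),
      (∀ s, (A s).toLinearPMap = SpectralFlow.twistedOperator (s : ℝ)) ∧
      (∀ P : SpectralFlow.SpectralPartition A, P.value = 1) ∧
      SpectralFlow.spectralFlow A = 1 ∧
      ∃ hclosed :
        A ⟨-Real.pi, Set.left_mem_Icc.mpr (neg_le_self Real.pi_pos.le)⟩ =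
          A ⟨Real.pi, Set.right_mem_Icc.mpr (neg_le_self Real.pi_pos.le)⟩,
        FundamentalGroup.fromPath (Path.Homotopic.Quotient.mk
          (SpectralFlow.loopOfClosedPath (neg_le_self Real.pi_pos.le) A hclosed)) ≠ 1 := by
  let A : C(Set.Icc (-Real.pi) Real.pi, SpectralFlow.SelfAdjointFredholm SpectralFlow.L2I) :=
    ⟨fun s => SpectralFlow.twistedFredholm s,
      SpectralFlow.continuous_twistedFredholm.comp continuous_subtype_val⟩
  have hA : ∀ s, (A s).toLinearPMap = SpectralFlow.twistedOperator (s : ℝ) := fun s => rfl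
  refine ⟨A, hA, SpectralFlow.SpectralPartition.value_eq_one hA, ?_,
    SpectralFlow.twistedFredholm_neg_pi, fun h => ?_⟩
  · rw [SpectralFlow.spectralFlow, dif_pos (SpectralFlow.nonempty_spectralPartition hA)]
    exact SpectralFlow.SpectralPartition.value_eq_one hA _
  · exact SpectralFlow.not_homotopic_refl A hA _ _ (Path.Homotopic.Quotient.eq.mp h)
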